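/- Let $M$ be a compact smooth $3$-manifold without boundary with a Riemannian metric, let $\varphi:M\to M$ be a $C^2$ diffeomorphism, and let $TM=E\oplus F$ be a $D\varphi$-invariant Lipschitz decomposition with $\dim E=2$ and $\dim F=1$ (that is, $E$ and $F$ have, near every point, frames of vector fields that are Lipschitz in charts). Let $(x^1,x^2,x^3)$ be a smooth chart of $M$, write $\partial_i=\partial/\partial x^i$, and let $\mathcal U\subset M$ be an open set whose closure is contained in the domain of the chart. Let $a,b$ be functions on $\mathcal U$, Lipschitz in the coordinates of the chart, such that $$X=\partial_1+a\,\partial_3,\qquad Y=\partial_2+b\,\partial_3$$ form a frame of $E$ on $\mathcal U$. Call $E$ differentiable at $x$ if in a neighbourhood of $x$ it has a frame of vector fields that are differentiable at $x$; the bracket $[X,Y]_x$ is then defined. (1) There is a constant $C>0$ such that for every integer $k\ge 0$ and every $x\in\mathcal U$ at which $E$ is differentiable, $$\|[X,Y]_x\|\le C\,\frac{|\det(D\varphi^k_x|_{E_x})|}{|\det(D\varphi^k_x|_{F_x})|},$$ where the norm and the determinants (volume-scaling factors of $D\varphi^k_x:E_x\to E_{\varphi^k x}$ and $D\varphi^k_x:F_x\to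 F_{\varphi^k x}$) are taken with respect to the Riemannian metric. (2) Suppose moreover that the decomposition is volume dominated, i.e. for some Riemannian metric on $M$ one has $|\det(D\varphi_x|_{E_x})|/|\det(D\varphi_x|_{F_x})|<1$ for all $x\in M$. Then $[X,Y]_x=0$ at every $x\in\mathcal U$ at which $E$ is differentiable; and at almost every point $x\in\mathcal U$ (for Lebesgue measure in the chart) $E$ is differentiable and $[X,Y]_x=0$. -/

import Mathlib

open Set Filter Topology MeasureTheory
open scoped Manifold ContDiff

noncomputable section

namespace LipBracket

/-- The model space of a 3-manifold: Euclidean 3-space. -/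
abbrev R3 : Type := EuclideanSpace ℝ (Fin 3)

section Manifold

variable {M : Type*} [TopologicalSpace M] [ChartedSpace R3 M]

/-- A (not necessarily continuous) vector field on a 3-manifold. -/
abbrev VField (M : Type*) [TopologicalSpace M] [ChartedSpace R3 M] : Type _ :=
  (x : M) → TangentSpace (𝓡 3) x

/-- A field of linear subspaces of the tangent spaces. -/
abbrev PlaneField (M : Type*) [TopologicalSpace M] [ChartedSpace R3 M] : Type _ :=
  (x : M) → Submodule ℝ (TangentSpace (𝓡 3) x)

/-- A Riemannian metric on the tangent bundle: positive definite inner products on the tangent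
spaces, depending continuously on the base point (so every smooth metric is one). -/
abbrev Metric (M : Type*) [TopologicalSpace M] [ChartedSpace R3 M]
    [IsManifold (𝓡 3) ∞ M] : Type _ :=
  haveI : IsManifold (𝓡 3) 1 M := IsManifold.of_le (n := ∞) (by norm_num)
  Bundle.ContinuousRiemannianMetric R3 (fun x : M => TangentSpace (𝓡 3) x)

/-- The norm of a tangent vector for the metric `g`. -/
def gNorm [IsManifold (𝓡 3) ∞ M] (g : Metric M) {x : M} (v : TangentSpace (𝓡 3) x) : ℝ :=
  Real.sqrt (g.inner x v v)

/-- The Gram matrix of a finite family of tangent vectors at `x` for the metric `g`. -/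
def gram [IsManifold (𝓡 3) ∞ M] (g : Metric M) {x : M} {ι : Type*}
    (v : ι → TangentSpace (𝓡 3) x) : Matrix ι ι ℝ :=
  Matrix.of fun i j => g.inner x (v i) (v j)

/-- `|det (A|_S)|` for a linear map `A : T_x M → T_y M` and a subspace `S` of `T_x M`, where `S`
and `A S` carry the inner products induced by `g`: the factor by which `A` multiplies the volume
of the parallelepiped spanned by a basis of `S`. It does not depend on the basis, see
`absDetOn_eq`. -/
def absDetOn [IsManifold (𝓡 3) ∞ M] (g : Metric M) {x y : M}
    (A : TangentSpace (𝓡 3) x →L[ℝ] TangentSpace (𝓡 3) y)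
    (S : Submodule ℝ (TangentSpace (𝓡 3) x)) : ℝ :=
  haveI : Module.Finite ℝ (TangentSpace (𝓡 3) x) := inferInstanceAs (Module.Finite ℝ R3)
  Real.sqrt (gram g (fun i => A (Module.finBasis ℝ S i : TangentSpace (𝓡 3) x))).det /
    Real.sqrt (gram g (fun i => (Module.finBasis ℝ S i : TangentSpace (𝓡 3) x))).det

/-- A linear change of a family of vectors multiplies the Gram determinant by the square of the
determinant of the change. -/
theorem gram_det_comp [IsManifold (𝓡 3) ∞ M] (g : Metric M) {x : M} {ι : Type*}
    [Fintype ι] [DecidableEq ι] (v : ι → TangentSpace (𝓡 3) x) (P : Matrix ι ι ℝ) :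
    (gram g (fun i => ∑ k, P k i • v k)).det = P.det ^ 2 * (gram g v).det := by
  have h : gram g (fun i => ∑ k, P k i • v k) = P.transpose * gram g v * P := by
    ext i j
    simp only [gram, Matrix.of_apply, Matrix.mul_apply, Matrix.transpose_apply, map_sum, map_smul,
      sum_apply, smul_apply, smul_eq_mul,
      Finset.sum_mul, Finset.mul_sum]
    refine Finset.sum_congr rfl fun k _ => Finset.sum_congr rfl fun l _ => ?_
    ring
  rw [h, Matrix.det_mul, Matrix.det_mul, Matrix.det_transpose]
  ring

/-- `absDetOn` may be computed in any basis of the subspace. -/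
theorem absDetOn_eq [IsManifold (𝓡 3) ∞ M] (g : Metric M) {x y : M}
    (A : TangentSpace (𝓡 3) x →L[ℝ] TangentSpace (𝓡 3) y)
    (S : Submodule ℝ (TangentSpace (𝓡 3) x))
    (b : Module.Basis (Fin (Module.finrank ℝ S)) ℝ S) :
    absDetOn g A S =
      Real.sqrt (gram g (fun i => A (b i : TangentSpace (𝓡 3) x))).det /
        Real.sqrt (gram g (fun i => (b i : TangentSpace (𝓡 3) x))).det := by
  have : Module.Finite ℝ (TangentSpace (𝓡 3) x) := inferInstanceAs (Module.Finite ℝ R3)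
  set c := Module.finBasis ℝ S with hc
  set P := b.toMatrix c with hP
  have hcb : ∀ i, (c i : TangentSpace (𝓡 3) x)
      = ∑ k, P k i • (b k : TangentSpace (𝓡 3) x) := by
    intro i
    have h := congrArg (S.subtype) (b.sum_toMatrix_smul_self c i)
    rw [map_sum] at h
    simpa [hP] using h.symm
  have hAcb : ∀ i, A (c i : TangentSpace (𝓡 3) x)
      = ∑ k, P k i • A (b k : TangentSpace (𝓡 3) x) := by
    intro i
    rw [hcb i, map_sum]
    simp
  have hdet : P.det ≠ 0 := by
    have h1 : P * c.toMatrix b = 1 := b.toMatrix_mul_toMatrix_flip c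
    intro h0
    have h2 := congrArg Matrix.det h1
    rw [Matrix.det_mul, h0] at h2
    simp at h2
  have e1 := gram_det_comp g (fun k => (b k : TangentSpace (𝓡 3) x)) P
  have e2 := gram_det_comp g (fun k => A (b k : TangentSpace (𝓡 3) x)) P
  have f1 : (fun i => (c i : TangentSpace (𝓡 3) x))
      = fun i => ∑ k, P k i • (b k : TangentSpace (𝓡 3) x) := funext hcb
  have f2 : (fun i => A (c i : TangentSpace (𝓡 3) x))
      = fun i => ∑ k, P k i • A (b k : TangentSpace (𝓡 3) x) := funext hAcb
  unfold absDetOn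
  rw [← hc, f1, f2, e1, e2, Real.sqrt_mul (sq_nonneg _), Real.sqrt_mul (sq_nonneg _)]
  exact mul_div_mul_left _ _ (by rw [Real.sqrt_sq_eq_abs]; exact abs_ne_zero.mpr hdet)

/-- The vectors `V₁ y, …, V_r y` form a basis of `D y` for every `y` in `U`. -/
def IsFrameOn (D : PlaneField M) {r : ℕ} (V : Fin r → VField M) (U : Set M) : Prop :=
  ∀ y ∈ U, LinearIndependent ℝ (fun i => V i y) ∧ Submodule.span ℝ (range fun i => V i y) = D y

/-- The vector field `V` read in the chart `e`, as a map of Euclidean space into itself. -/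
def inChart (e : OpenPartialHomeomorph M R3) (V : VField M) : R3 → R3 :=
  fun p => mfderiv (𝓡 3) (𝓡 3) e (e.symm p) (V (e.symm p))

/-- A rank `r` Lipschitz distribution: near every point it has a frame of vector fields that are
Lipschitz in the chart at that point. -/
def IsLipschitzDistribution (r : ℕ) (D : PlaneField M) : Prop :=
  ∀ x₀ : M, ∃ U : Set M, IsOpen U ∧ x₀ ∈ U ∧ U ⊆ (chartAt R3 x₀).source ∧
    ∃ V : Fin r → VField M, IsFrameOn D V U ∧
      ∀ i, ∃ K, LipschitzOnWith K (inChart (chartAt R3 x₀) (V i)) (chartAt R3 x₀ '' U)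

/-- A rank `r` distribution is differentiable at `x`: in a neighbourhood of `x` it has a frame of
vector fields that are differentiable at `x`. -/
def IsDifferentiableAt [IsManifold (𝓡 3) ∞ M] (r : ℕ) (D : PlaneField M) (x : M) : Prop :=
  haveI : IsManifold (𝓡 3) 1 M := IsManifold.of_le (n := ∞) (by norm_num)
  ∃ U : Set M, IsOpen U ∧ x ∈ U ∧ ∃ V : Fin r → VField M, IsFrameOn D V U ∧
    ∀ i, MDifferentiableAt (𝓡 3) (𝓡 3).tangent
      (fun y => (⟨y, V i y⟩ : TangentBundle (𝓡 3) M)) x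

/-- `E ⊕ F` is a `Dφ`-invariant Lipschitz decomposition of the tangent bundle into a plane bundle
`E` and a line bundle `F`. -/
structure IsInvariantLipschitzSplitting (φ : M → M) (E F : PlaneField M) : Prop where
  lipschitz_left : IsLipschitzDistribution 2 E
  lipschitz_right : IsLipschitzDistribution 1 F
  isCompl : ∀ x, IsCompl (E x) (F x)
  map_left : ∀ x, (E x).map (mfderiv (𝓡 3) (𝓡 3) φ x).toLinearMap = E (φ x)
  map_right : ∀ x, (F x).map (mfderiv (𝓡 3) (𝓡 3) φ x).toLinearMap = F (φ x)

/-- `|det Dφᵏ|_{E_x}| / |det Dφᵏ|_{F_x}|`, with determinants taken for the metric `g`. -/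
def detRatio [IsManifold (𝓡 3) ∞ M] (g : Metric M) (φ : M → M) (E F : PlaneField M)
    (k : ℕ) (x : M) : ℝ :=
  absDetOn g (mfderiv (𝓡 3) (𝓡 3) (φ^[k]) x) (E x) /
    absDetOn g (mfderiv (𝓡 3) (𝓡 3) (φ^[k]) x) (F x)

/-- Volume domination of the decomposition `E ⊕ F`. -/
def IsVolumeDominated [IsManifold (𝓡 3) ∞ M] (φ : M → M) (E F : PlaneField M) : Prop :=
  ∃ g : Metric M, ∀ x, detRatio g φ E F 1 x < 1

/-- The coordinate vector field `∂/∂xⁱ` of the chart `e` (meaningful on `e.source`). -/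
def coordField (e : OpenPartialHomeomorph M R3) (i : Fin 3) : VField M := fun x =>
  mfderiv (𝓡 3) (𝓡 3) e.symm (e x) (EuclideanSpace.single i (1 : ℝ))

/-- The vector field `∂/∂xⁱ + a ∂/∂x³`, where `∂/∂x¹, ∂/∂x², ∂/∂x³` (indexed by `0, 1, 2`) are the
coordinate vector fields of the chart `e`. -/
def graphField (e : OpenPartialHomeomorph M R3) (i : Fin 3) (a : M → ℝ) : VField M := fun x =>
  coordField e i x + a x • coordField e 2 x

end Manifold

end LipBracket

end

/-! On `U` the plane field `E` is the kernel of η = dx³ - a dx¹ - b dx², and [X,Y] = -dη(X,Y) ∂₃ at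
a point where `E` is differentiable; so the task is to bound dη on `E`. Let Φ = φᵏ. By compactness
`E` is, near every point y of `M`, the kernel of a normalised 1-form ν whose increments from y are
bounded by a constant independent of y, and which is bounded below on `F` at y
(`exists_isControlledAt`). Take ν at y = Φ(x). By invariance of `E`, Φ*ν = l η for a scalar function
l. On ker η the derivative of l drops out, so |l| |dη(X,Y)| is the size of d(Φ*ν)(X,Y). The second
derivatives of Φ cancel by symmetry, and what remains is at most 2C |DΦ X| |DΦ Y|
(`pullback_form_bound`).

Only `E` at x is assumed differentiable. The normalisation of ν transports this to ν ∘ Φ at x, and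
the uniform Lipschitz bound then controls its derivative along v by |DΦ v|, however large k is.

Subtracting a multiple of X from Y makes DΦ X and DΦ Y orthogonal without changing dη(X,Y), so the
product of lengths becomes an area, comparable to |det DΦ|_E|. Evaluating Φ*ν = l η on a vector of
`F` shows that |l| is at least a constant times |det DΦ|_F|. Division gives (1)
(`mul_bracketCoeff_le`, `bracketCoeff_le`).

For (2), the determinant ratio is a multiplicative cocycle, continuous on a compact space and less
than 1, hence at most some τ < 1; its iterates decay like τᵏ and the bound forces the bracket to
vanish. Rademacher's theorem for `a` and `b` gives differentiability almost everywhere. -/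

namespace LipBracket

/-! ### Exterior derivative of a pulled-back form, using only increments. -/

section Calculus

variable {V W G : Type*} [NormedAddCommGroup V] [NormedSpace ℝ V] [NormedAddCommGroup W]
  [NormedSpace ℝ W] [NormedAddCommGroup G] [NormedSpace ℝ G]

/-- If the increments of `N` at `p` are dominated by those of `ψ`, so are the derivatives. -/
theorem norm_deriv_le_of_increment_le {N : V → G} {ψ : V → W} {p : V} {N' : V →L[ℝ] G}
    {ψ' : V →L[ℝ] W} (hN : HasFDerivAt N N' p) (hψ : HasFDerivAt ψ ψ' p) {K : ℝ}
    (hK : ∀ᶠ q in 𝓝 p, ‖N q - N p‖ ≤ K * ‖ψ q - ψ p‖) (v : V) :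
    ‖N' v‖ ≤ K * ‖ψ' v‖ := by
  have h1 := (hN.hasLineDerivAt v).tendsto_slope_zero
  have h2 := (hψ.hasLineDerivAt v).tendsto_slope_zero
  refine le_of_tendsto_of_tendsto h1.norm (h2.norm.const_mul K) ?_
  have hc : Tendsto (fun t : ℝ => p + t • v) (𝓝[≠] 0) (𝓝 p) := by
    have : ContinuousAt (fun t : ℝ => p + t • v) 0 := by fun_prop
    have h := this.tendsto
    simp only [zero_smul, add_zero] at h
    exact h.mono_left nhdsWithin_le_nhds
  filter_upwards [hc.eventually hK] with t ht
  rw [norm_smul, norm_smul, mul_left_comm]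
  exact mul_le_mul_of_nonneg_left ht (norm_nonneg _)

/-- Let `ψ` pull the `1`-form whose coefficients along `ψ` are `N` back to `l • η`. On the kernel
of `η`, the exterior derivative of `l • η` is bounded by the increments of `N`. -/
theorem pullback_form_bound [CompleteSpace V] {ψ : V → W} {p : V} (hψ : ContDiffAt ℝ 2 ψ p)
    (hinv : (fderiv ℝ ψ p).IsInvertible) {η : V → V →L[ℝ] ℝ} (hη : DifferentiableAt ℝ η p)
    {N : V → W →L[ℝ] ℝ} {l : V → ℝ}
    (hN : ∀ᶠ q in 𝓝 p, (N q).comp (fderiv ℝ ψ q) = l q • η q)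
    {w₀ : W} (hw : ∀ᶠ q in 𝓝 p, N q w₀ = 1)
    {K : ℝ} (hK : ∀ᶠ q in 𝓝 p, ‖N q - N p‖ ≤ K * ‖ψ q - ψ p‖)
    {u v : V} (hu : η p u = 0) (hv : η p v = 0) :
    |l p| * |fderiv ℝ η p v u - fderiv ℝ η p u v|
      ≤ 2 * K * (‖fderiv ℝ ψ p u‖ * ‖fderiv ℝ ψ p v‖) := by
  have hD : DifferentiableAt ℝ (fderiv ℝ ψ) p :=
    (hψ.fderiv_right (m := 1) (by norm_num)).differentiableAt (by norm_num)
  set J : V → W →L[ℝ] V := fun q => (fderiv ℝ ψ q).inverse with hJ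
  have hJd : DifferentiableAt ℝ J p :=
    ((hinv.contDiffAt_map_inverse (n := 1)).differentiableAt (by norm_num)).comp p hD
  have hev : ∀ᶠ q in 𝓝 p, (fderiv ℝ ψ q).IsInvertible := by
    obtain ⟨M, hM⟩ := hinv
    have := ContinuousLinearEquiv.nhds M
    rw [hM] at this
    exact hD.continuousAt.eventually this
  -- The pullback identity is evaluated at `J q w₀`, the vector that the derivative of `ψ` sends to
  -- `w₀`.
  have hμ : ∀ᶠ q in 𝓝 p, l q * η q (J q w₀) = 1 := by
    filter_upwards [hN, hw, hev] with q h1 h2 h3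
    have := congrArg (fun T => T (J q w₀)) h1
    simp only [ContinuousLinearMap.comp_apply, smul_apply, smul_eq_mul] at this
    rw [← this, ← h2]
    congr 1
    obtain ⟨M, hM⟩ := h3
    simp [hJ, ← hM]
  have hμ0 : η p (J p w₀) ≠ 0 := right_ne_zero_of_mul_eq_one hμ.self_of_nhds
  -- Neither `l` nor `N` is assumed differentiable: by the normalisation, `l` is the inverse of a
  -- differentiable function, and then `N` is `l • η` composed with the inverse of the derivative of
  -- `ψ`.
  have hl : DifferentiableAt ℝ l p := by
    have h1 : DifferentiableAt ℝ (fun q => (η q (J q w₀))⁻¹) p :=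
      (hη.clm_apply (hJd.clm_apply (differentiableAt_const w₀))).inv hμ0
    refine h1.congr_of_eventuallyEq ?_
    filter_upwards [hμ] with q h
    exact eq_inv_of_mul_eq_one_left h
  have hNd : DifferentiableAt ℝ N p := by
    have h1 : DifferentiableAt ℝ (fun q => l q • (η q).comp (J q)) p :=
      hl.smul (hη.clm_comp hJd)
    refine h1.congr_of_eventuallyEq ?_
    filter_upwards [hN, hev] with q h h3
    obtain ⟨M, hM⟩ := h3
    ext w
    have := congrArg (fun T => T (J q w)) h
    simp only [ContinuousLinearMap.comp_apply, smul_apply, smul_eq_mul] at this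
    simp only [smul_apply, ContinuousLinearMap.comp_apply, smul_eq_mul, ← this]
    simp [hJ, ← hM]
  -- Differentiate the pullback identity, evaluated at `s`, in the direction `t`; the term with the
  -- derivative of `l` carries the factor `η p s = 0`.
  have key : ∀ s t : V, η p s = 0 →
      fderiv ℝ N p t (fderiv ℝ ψ p s) + N p (fderiv ℝ (fderiv ℝ ψ) p t s)
        = l p * fderiv ℝ η p t s := by
    intro s t hs
    have e1 := (hNd.hasFDerivAt.clm_apply
      (hD.hasFDerivAt.clm_apply (hasFDerivAt_const s p)))
    have e2 := hl.hasFDerivAt.mul (hη.hasFDerivAt.clm_apply (hasFDerivAt_const s p))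
    have e3 : HasFDerivAt (fun q => l q * η q s) _ p :=
      e1.congr_of_eventuallyEq (by
        filter_upwards [hN] with q h
        have := congrArg (fun T => T s) h
        simpa using this.symm)
    have := congrArg (fun T => T t) (e3.unique e2)
    simp only [add_apply, ContinuousLinearMap.comp_apply,
      ContinuousLinearMap.flip_apply, smul_apply, smul_eq_mul, hs,
      zero_apply, map_zero, zero_add, zero_mul, add_zero] at this
    linarith
  have hsymm : fderiv ℝ (fderiv ℝ ψ) p u v = fderiv ℝ (fderiv ℝ ψ) p v u :=
    (hψ.isSymmSndFDerivAt (by simp)).eq u v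
  have k1 := key u v hu
  have k2 := key v u hv
  have b := norm_deriv_le_of_increment_le hNd.hasFDerivAt
    (hψ.differentiableAt (by norm_num)).hasFDerivAt hK
  have e : l p * (fderiv ℝ η p v u - fderiv ℝ η p u v)
      = fderiv ℝ N p v (fderiv ℝ ψ p u) - fderiv ℝ N p u (fderiv ℝ ψ p v) := by
    rw [mul_sub, ← k1, ← k2, hsymm]; ring
  rw [← abs_mul, e]
  have c1 := ((fderiv ℝ N p v).le_opNorm (fderiv ℝ ψ p u)).trans
    (mul_le_mul_of_nonneg_right (b v) (norm_nonneg _))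
  have c2 := ((fderiv ℝ N p u).le_opNorm (fderiv ℝ ψ p v)).trans
    (mul_le_mul_of_nonneg_right (b u) (norm_nonneg _))
  have c3 := norm_sub_le (fderiv ℝ N p v (fderiv ℝ ψ p u)) (fderiv ℝ N p u (fderiv ℝ ψ p v))
  rw [Real.norm_eq_abs] at c3
  linarith

end Calculus

/-! ### Planes in Euclidean 3-space as kernels of determinants. -/

section Triple

/-- The determinant of three vectors of Euclidean 3-space. -/
def triple (u v w : R3) : ℝ :=
  u 0 * (v 1 * w 2 - v 2 * w 1) + u 1 * (v 2 * w 0 - v 0 * w 2) + u 2 * (v 0 * w 1 - v 1 * w 0)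

/-- The linear form `w ↦ det (u, v, w)`. -/
noncomputable def tripleForm (u v : R3) : R3 →L[ℝ] ℝ :=
  (u 1 * v 2 - u 2 * v 1) • EuclideanSpace.proj (0 : Fin 3)
    + (u 2 * v 0 - u 0 * v 2) • EuclideanSpace.proj (1 : Fin 3)
    + (u 0 * v 1 - u 1 * v 0) • EuclideanSpace.proj (2 : Fin 3)

theorem tripleForm_apply (u v w : R3) : tripleForm u v w = triple u v w := by
  simp [tripleForm, triple]
  ring

theorem triple_ne_zero_iff (u v w : R3) :
    triple u v w ≠ 0 ↔ LinearIndependent ℝ ![u, v, w] := by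
  have h1 : LinearIndependent ℝ ![u, v, w]
      ↔ LinearIndependent ℝ (Matrix.of ![u.ofLp, v.ofLp, w.ofLp]).row := by
    rw [← LinearMap.linearIndependent_iff
      (WithLp.linearEquiv 2 ℝ (Fin 3 → ℝ)).toLinearMap (LinearEquiv.ker _)]
    have : (⇑(WithLp.linearEquiv 2 ℝ (Fin 3 → ℝ)).toLinearMap ∘ ![u, v, w])
        = (Matrix.of ![u.ofLp, v.ofLp, w.ofLp]).row := by
      funext i; fin_cases i <;> rfl
    rw [this]
  rw [h1, Matrix.linearIndependent_rows_iff_isUnit, Matrix.isUnit_iff_isUnit_det,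
    isUnit_iff_ne_zero, Matrix.det_fin_three]
  have : triple u v w = (Matrix.of ![u.ofLp, v.ofLp, w.ofLp]).det := by
    rw [Matrix.det_fin_three]; simp [triple]; ring
  rw [this, Matrix.det_fin_three]

theorem triple_eq_zero_iff_mem_span {V : Fin 2 → R3} (hV : LinearIndependent ℝ V) (w : R3) :
    triple (V 0) (V 1) w = 0 ↔ w ∈ Submodule.span ℝ (range V) := by
  have h : LinearIndependent ℝ ![V 0, V 1, w] ↔ w ∉ Submodule.span ℝ (range V) := by
    have : ![V 0, V 1, w] = Fin.snoc V w := by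
      funext i; fin_cases i <;> rfl
    rw [this, linearIndependent_finSnoc]
    exact and_iff_right hV
  have h2 := (triple_ne_zero_iff (V 0) (V 1) w).trans h
  exact not_iff_not.mp h2

end Triple

/-! ### Lengths, areas and Gram determinants for the metric. -/

section MetricNorm

variable {M : Type*} [TopologicalSpace M] [ChartedSpace R3 M] [IsManifold (𝓡 3) ∞ M]

theorem gNorm_nonneg (g : Metric M) {x : M} (v : TangentSpace (𝓡 3) x) : 0 ≤ gNorm g v :=
  Real.sqrt_nonneg _

theorem metric_inner_self_nonneg (g : Metric M) {x : M} (v : TangentSpace (𝓡 3) x) :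
    0 ≤ g.inner x v v := by
  by_cases h : v = 0
  · simp [h]
  · exact (g.pos x v h).le

theorem gNorm_pos (g : Metric M) {x : M} {v : TangentSpace (𝓡 3) x} (hv : v ≠ 0) :
    0 < gNorm g v :=
  Real.sqrt_pos.mpr (g.pos x v hv)

theorem gNorm_smul (g : Metric M) {x : M} (c : ℝ) (v : TangentSpace (𝓡 3) x) :
    gNorm g (c • v) = |c| * gNorm g v := by
  have : g.inner x (c • v) (c • v) = c ^ 2 * g.inner x v v := by
    simp; ring
  rw [gNorm, this, Real.sqrt_mul (sq_nonneg c), Real.sqrt_sq_eq_abs, gNorm]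

theorem gram_one (g : Metric M) {x : M} (v : Fin 1 → TangentSpace (𝓡 3) x) :
    √(gram g v).det = gNorm g (v 0) := by
  simp [gram, gNorm]

theorem gram_two_le (g : Metric M) {x : M} (v : Fin 2 → TangentSpace (𝓡 3) x) :
    √(gram g v).det ≤ gNorm g (v 0) * gNorm g (v 1) := by
  rw [gNorm, gNorm, ← Real.sqrt_mul (metric_inner_self_nonneg g _)]
  refine Real.sqrt_le_sqrt ?_
  rw [Matrix.det_fin_two]
  simp only [gram, Matrix.of_apply]
  rw [g.symm x (v 1) (v 0)]
  nlinarith [mul_self_nonneg (g.inner x (v 0) (v 1))]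

/-- The area spanned by two vectors is the product of the lengths of the first one and of the
component of the second one orthogonal to it. -/
theorem exists_gNorm_mul_eq_sqrt_gram (g : Metric M) {x : M} (v : Fin 2 → TangentSpace (𝓡 3) x)
    (hv : v 0 ≠ 0) :
    ∃ c : ℝ, gNorm g (v 0) * gNorm g (v 1 - c • v 0) = √(gram g v).det := by
  have hp := g.pos x (v 0) hv
  refine ⟨g.inner x (v 0) (v 1) / g.inner x (v 0) (v 0), ?_⟩
  rw [gNorm, gNorm, ← Real.sqrt_mul (metric_inner_self_nonneg g _)]
  congr 1
  rw [Matrix.det_fin_two]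
  simp only [gram, Matrix.of_apply, map_sub, map_smul, sub_apply, smul_apply, smul_eq_mul]
  rw [g.symm x (v 1) (v 0)]
  field_simp
  ring

theorem gram_det_pos (g : Metric M) {x : M} {v : Fin 2 → TangentSpace (𝓡 3) x}
    (hv : LinearIndependent ℝ v) : 0 < (gram g v).det := by
  have h0 : v 0 ≠ 0 := hv.ne_zero 0
  obtain ⟨c, hc⟩ := exists_gNorm_mul_eq_sqrt_gram g v h0
  have h1 : v 1 - c • v 0 ≠ 0 := by
    intro h
    have := Fintype.linearIndependent_iff.mp hv ![-c, 1] (by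
      simp only [Fin.sum_univ_two, Matrix.cons_val_zero, Matrix.cons_val_one, one_smul, neg_smul]
      rw [← h]; abel) 1
    simp at this
  have : 0 < √(gram g v).det := hc ▸ mul_pos (gNorm_pos g h0) (gNorm_pos g h1)
  exact Real.sqrt_pos.mp this

/-- `absDetOn` may be computed with any linearly independent family spanning the subspace. -/
theorem absDetOn_eq_of_span (g : Metric M) {x y : M}
    (A : TangentSpace (𝓡 3) x →L[ℝ] TangentSpace (𝓡 3) y)
    {S : Submodule ℝ (TangentSpace (𝓡 3) x)} {r : ℕ} {v : Fin r → TangentSpace (𝓡 3) x}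
    (hv : LinearIndependent ℝ v) (hS : Submodule.span ℝ (range v) = S) :
    absDetOn g A S = √(gram g (fun i => A (v i))).det / √(gram g v).det := by
  have hr : Module.finrank ℝ S = r := by
    rw [← hS, finrank_span_eq_card hv, Fintype.card_fin]
  subst hr
  have key := absDetOn_eq g A S ((Module.Basis.span hv).map (LinearEquiv.ofEq _ _ hS))
  simpa [Module.Basis.span_apply] using key

theorem Metric.continuousAt_inner (g : Metric M) {T : Type*} [TopologicalSpace T] {b : T → M}
    {v w : ∀ t, TangentSpace (𝓡 3) (b t)} {t₀ : T}
    (hv : ContinuousAt (fun t => (⟨b t, v t⟩ : TangentBundle (𝓡 3) M)) t₀)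
    (hw : ContinuousAt (fun t => (⟨b t, w t⟩ : TangentBundle (𝓡 3) M)) t₀) :
    ContinuousAt (fun t => g.inner (b t) (v t) (w t)) t₀ := by
  have : IsManifold (𝓡 3) 1 M := IsManifold.of_le (n := ∞) (by norm_num)
  have hb : ContinuousAt b t₀ := ((FiberBundle.continuousAt_totalSpace _ _).mp hv).1
  have h := ContinuousAt.clm_bundle_apply₂ (F₁ := R3) (F₂ := R3) (F₃ := ℝ)
    (E₃ := Bundle.Trivial M ℝ) (ContinuousAt.comp (g := fun b : M =>
      Bundle.TotalSpace.mk' (R3 →L[ℝ] R3 →L[ℝ] ℝ) b (g.inner b)) g.continuous.continuousAt hb) hv hw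
  exact ((FiberBundle.continuousAt_totalSpace _ _).mp h).2

end MetricNorm

/-! ### Chart derivatives and comparison of norms. -/

section Charts

variable {M : Type*} [TopologicalSpace M] [ChartedSpace R3 M]

/-- The derivative of a chart, with values in Euclidean space. -/
noncomputable def chartD (e : OpenPartialHomeomorph M R3) (x : M) :
    TangentSpace (𝓡 3) x →L[ℝ] R3 :=
  mfderiv (𝓡 3) (𝓡 3) e x

/-- The derivative of the inverse of a chart, as a map into the tangent space at `x`. -/
noncomputable def chartDinv (e : OpenPartialHomeomorph M R3) (x : M) :
    R3 →L[ℝ] TangentSpace (𝓡 3) x :=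
  mfderiv (𝓡 3) (𝓡 3) e.symm (e x)

variable {e : OpenPartialHomeomorph M R3}

theorem mdifferentiable_of_mem_maximalAtlas (he : e ∈ IsManifold.maximalAtlas (𝓡 3) ∞ M) :
    e.MDifferentiable (𝓡 3) (𝓡 3) :=
  ⟨(contMDiffOn_of_mem_maximalAtlas he).mdifferentiableOn (by simp),
    (contMDiffOn_symm_of_mem_maximalAtlas he).mdifferentiableOn (by simp)⟩

theorem chartDinv_chartD (he : e ∈ IsManifold.maximalAtlas (𝓡 3) ∞ M) {x : M}
    (hx : x ∈ e.source) (v : TangentSpace (𝓡 3) x) : chartDinv e x (chartD e x v) = v :=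
  congrArg (fun T => T v) ((mdifferentiable_of_mem_maximalAtlas he).symm_comp_deriv hx)

theorem chartD_injective (he : e ∈ IsManifold.maximalAtlas (𝓡 3) ∞ M) {x : M}
    (hx : x ∈ e.source) : Function.Injective (chartD e x) :=
  Function.LeftInverse.injective (chartDinv_chartD he hx)

theorem chartD_chartDinv (he : e ∈ IsManifold.maximalAtlas (𝓡 3) ∞ M) {x : M}
    (hx : x ∈ e.source) (w : R3) : chartD e x (chartDinv e x w) = w := by
  obtain ⟨v, hv⟩ := (mdifferentiable_of_mem_maximalAtlas he).mfderiv_surjective hx w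
  have hv' : chartD e x v = w := hv
  rw [← hv', chartDinv_chartD he hx]

theorem chartDinv_injective (he : e ∈ IsManifold.maximalAtlas (𝓡 3) ∞ M) {x : M}
    (hx : x ∈ e.source) : Function.Injective (chartDinv e x) :=
  Function.LeftInverse.injective (chartD_chartDinv he hx)

theorem inChart_apply {x : M} (hx : x ∈ e.source) (V : VField M) :
    inChart e V (e x) = chartD e x (V x) := by
  -- The tangent space depends on the base point, so the point is generalised before `e.symm (e x)`
  -- is replaced by `x`.
  have : ∀ y, y = x → chartD e y (V y) = chartD e x (V x) := by
    rintro y rfl; rfl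
  exact this _ (e.left_inv hx)

variable [IsManifold (𝓡 3) ∞ M]

/-- Vectors with continuous chart coordinates depend continuously on the base point. -/
theorem continuousAt_chartDinv (he : e ∈ IsManifold.maximalAtlas (𝓡 3) ∞ M) {T : Type*}
    [TopologicalSpace T] {b : T → M} {w : T → R3} {t₀ : T} (hb : ContinuousAt b t₀)
    (hw : ContinuousAt w t₀) (ht : b t₀ ∈ e.source) :
    ContinuousAt (fun t => (⟨b t, chartDinv e (b t) (w t)⟩ : TangentBundle (𝓡 3) M)) t₀ := by
  have : IsManifold (𝓡 3) 1 M := IsManifold.of_le (n := ∞) (by norm_num)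
  have h := (contMDiffOn_symm_of_mem_maximalAtlas he).continuousOn_tangentMapWithin
    (by simp) e.open_target.uniqueMDiffOn
  have hnhds : (Bundle.TotalSpace.proj ⁻¹' e.target : Set (TangentBundle (𝓡 3) R3))
      ∈ 𝓝 (⟨e (b t₀), w t₀⟩ : TangentBundle (𝓡 3) R3) :=
    (e.open_target.preimage (FiberBundle.continuous_proj _ _)).mem_nhds (e.map_source ht)
  have h1 := h.continuousAt hnhds
  have h2 : ContinuousAt (fun t => (⟨e (b t), w t⟩ : TangentBundle (𝓡 3) R3)) t₀ :=
    ((tangentBundleModelSpaceHomeomorph (𝓡 3)).symm.continuous.continuousAt).comp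
      (((e.continuousAt ht).comp hb).prodMk hw)
  refine (ContinuousAt.comp (f := fun t => (⟨e (b t), w t⟩ : TangentBundle (𝓡 3) R3))
    h1 h2).congr ?_
  filter_upwards [hb.eventually (e.open_source.mem_nhds ht)] with t ht'
  simp only [Function.comp, tangentMapWithin]
  rw [mfderivWithin_of_mem_nhds (e.open_target.mem_nhds (e.map_source ht'))]
  have h3 : ∀ z, z = b t → ∀ u : R3, (⟨z, u⟩ : TangentBundle (𝓡 3) M) = ⟨b t, u⟩ := by
    rintro z rfl u; rfl
  exact h3 _ (e.left_inv ht') _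

/-- On a compact part of the domain of a chart, the metric norm and the norm of the coordinates are
comparable. -/
theorem exists_norm_comparison (g : Metric M) (he : e ∈ IsManifold.maximalAtlas (𝓡 3) ∞ M)
    {K : Set M} (hK : IsCompact K) (hKe : K ⊆ e.source) :
    ∃ C : ℝ, 0 < C ∧ ∀ y ∈ K, ∀ v : TangentSpace (𝓡 3) y,
      ‖chartD e y v‖ ≤ C * gNorm g v ∧ gNorm g v ≤ C * ‖chartD e y v‖ := by
  -- By homogeneity it suffices to bound `f` and its inverse on the compact product of `K` with the
  -- unit sphere.
  set f : M × R3 → ℝ := fun z => gNorm g (chartDinv e z.1 z.2) with hf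
  have hc : IsCompact (K ×ˢ Metric.sphere (0 : R3) 1) := hK.prod (isCompact_sphere _ _)
  have hfc : ContinuousOn f (K ×ˢ Metric.sphere (0 : R3) 1) := by
    rintro ⟨y, w⟩ ⟨hy, -⟩
    have := continuousAt_chartDinv he (T := M × R3) (b := Prod.fst) (w := Prod.snd)
      (t₀ := (y, w)) continuousAt_fst continuousAt_snd (hKe hy)
    exact (g.continuousAt_inner this this).sqrt.continuousWithinAt
  have hfp : ∀ z ∈ K ×ˢ Metric.sphere (0 : R3) 1, f z ≠ 0 := by
    rintro ⟨y, w⟩ ⟨hy, hw⟩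
    refine (gNorm_pos g ?_).ne'
    rw [(map_ne_zero_iff _ (chartDinv_injective he (hKe hy)))]
    rintro rfl
    have : ‖(0 : R3)‖ = 1 := mem_sphere_zero_iff_norm.mp hw
    simp at this
  obtain ⟨C₁, h₁⟩ := hc.exists_bound_of_continuousOn hfc
  obtain ⟨C₂, h₂⟩ := hc.exists_bound_of_continuousOn (hfc.inv₀ hfp)
  refine ⟨max (max C₁ C₂) 1, by positivity, fun y hy v => ?_⟩
  set w : R3 := chartD e y v with hw
  by_cases hw0 : w = 0
  · have : v = 0 := chartD_injective he (hKe hy) (hw0.trans (map_zero _).symm)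
    rw [hw0, this]
    simp [gNorm]
  have hn : 0 < ‖w‖ := norm_pos_iff.mpr hw0
  have hmem : (y, ‖w‖⁻¹ • w) ∈ K ×ˢ Metric.sphere (0 : R3) 1 := by
    refine ⟨hy, ?_⟩
    rw [mem_sphere_zero_iff_norm, norm_smul, norm_inv, norm_norm, inv_mul_cancel₀ hn.ne']
  have hfv : f (y, ‖w‖⁻¹ • w) = ‖w‖⁻¹ * gNorm g v := by
    simp only [hf]
    rw [map_smul, hw, chartDinv_chartD he (hKe hy), gNorm_smul, abs_of_pos (inv_pos.mpr hn)]
  have b1 := h₁ _ hmem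
  have b2 := h₂ _ hmem
  rw [Pi.inv_apply] at b2
  rw [hfv] at b1 b2
  have hv0 : 0 < gNorm g v := by
    refine gNorm_pos g fun h => hw0 ?_
    rw [hw, h, map_zero]
  rw [Real.norm_of_nonneg (by positivity)] at b1 b2
  have m1 : C₁ ≤ max (max C₁ C₂) 1 := (le_max_left _ _).trans (le_max_left _ _)
  have m2 : C₂ ≤ max (max C₁ C₂) 1 := (le_max_right _ _).trans (le_max_left _ _)
  constructor
  · rw [mul_inv, inv_inv] at b2
    have := mul_le_mul_of_nonneg_right (b2.trans m2) hv0.le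
    rwa [mul_assoc, inv_mul_cancel₀ hv0.ne', mul_one] at this
  · have := mul_le_mul_of_nonneg_right (b1.trans m1) hn.le
    rwa [mul_right_comm, inv_mul_cancel₀ hn.ne', one_mul] at this

end Charts

/-! ### Normalised 1-forms attached to planes. -/

section NormalForm

/-- The linear form with kernel the span of `u` and `v`, normalised to take the value `1` at
`w₀`. -/
noncomputable def normalForm (w₀ : R3) (z : R3 × R3) : R3 →L[ℝ] ℝ :=
  (triple z.1 z.2 w₀)⁻¹ • tripleForm z.1 z.2

theorem normalForm_apply (w₀ u v w : R3) :
    normalForm w₀ (u, v) w = (triple u v w₀)⁻¹ * triple u v w := by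
  simp [normalForm, tripleForm_apply]

theorem contDiff_euclidean_coord (i : Fin 3) : ContDiff ℝ 1 fun z : R3 => z i :=
  (EuclideanSpace.proj (𝕜 := ℝ) i : R3 →L[ℝ] ℝ).contDiff

theorem contDiff_triple (w₀ : R3) : ContDiff ℝ 1 fun z : R3 × R3 => triple z.1 z.2 w₀ := by
  have h1 : ∀ i, ContDiff ℝ 1 fun z : R3 × R3 => z.1 i :=
    fun i => (contDiff_euclidean_coord i).comp contDiff_fst
  have h2 : ∀ i, ContDiff ℝ 1 fun z : R3 × R3 => z.2 i :=
    fun i => (contDiff_euclidean_coord i).comp contDiff_snd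
  unfold triple
  fun_prop

/-- Being C¹ in the frame makes the form locally Lipschitz in the frame, so a Lipschitz frame yields
a Lipschitz form. -/
theorem contDiffAt_normalForm {w₀ u v : R3} (h : triple u v w₀ ≠ 0) :
    ContDiffAt ℝ 1 (normalForm w₀) (u, v) := by
  have h1 : ∀ i, ContDiff ℝ 1 fun z : R3 × R3 => z.1 i :=
    fun i => (contDiff_euclidean_coord i).comp contDiff_fst
  have h2 : ∀ i, ContDiff ℝ 1 fun z : R3 × R3 => z.2 i :=
    fun i => (contDiff_euclidean_coord i).comp contDiff_snd
  have h3 : ContDiff ℝ 1 fun z : R3 × R3 => tripleForm z.1 z.2 := by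
    unfold tripleForm
    fun_prop
  exact ((contDiff_triple w₀).contDiffAt.inv h).smul h3.contDiffAt

end NormalForm

/-! ### Frames read in a chart. -/

section Frames

variable {M : Type*} [TopologicalSpace M] [ChartedSpace R3 M]
  {e : OpenPartialHomeomorph M R3} {E F : PlaneField M}

theorem IsFrameOn.span_inChart {D : PlaneField M} {r : ℕ} {V : Fin r → VField M} {U : Set M}
    (hV : IsFrameOn D V U) {y : M} (hy : y ∈ U) (hye : y ∈ e.source) :
    Submodule.span ℝ (range fun i => inChart e (V i) (e y))
      = (D y).map (chartD e y).toLinearMap := by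
  rw [← (hV y hy).2, Submodule.map_span, ← range_comp]
  congr 2
  funext i
  exact inChart_apply hye (V i)

theorem IsFrameOn.linearIndependent_inChart {D : PlaneField M} {r : ℕ} {V : Fin r → VField M}
    {U : Set M} (hV : IsFrameOn D V U) (he : e ∈ IsManifold.maximalAtlas (𝓡 3) ∞ M) {y : M}
    (hy : y ∈ U) (hye : y ∈ e.source) :
    LinearIndependent ℝ fun i => inChart e (V i) (e y) := by
  have h := (hV y hy).1.map' (chartD e y).toLinearMap
    (LinearMap.ker_eq_bot.mpr (chartD_injective he hye))
  have h2 : (fun i => inChart e (V i) (e y)) = (chartD e y).toLinearMap ∘ fun i => V i y := by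
    funext i
    exact inChart_apply hye (V i)
  rwa [h2]

theorem IsFrameOn.triple_eq_zero_iff {V : Fin 2 → VField M} {U : Set M} (hV : IsFrameOn E V U)
    (he : e ∈ IsManifold.maximalAtlas (𝓡 3) ∞ M) {y : M} (hy : y ∈ U) (hye : y ∈ e.source)
    (v : TangentSpace (𝓡 3) y) :
    triple (inChart e (V 0) (e y)) (inChart e (V 1) (e y)) (chartD e y v) = 0 ↔ v ∈ E y := by
  rw [triple_eq_zero_iff_mem_span (hV.linearIndependent_inChart he hy hye),
    hV.span_inChart hy hye]
  refine ⟨?_, fun h => Submodule.mem_map_of_mem h⟩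
  rintro ⟨w, hw, hwv⟩
  rwa [← chartD_injective he hye hwv]

end Frames

/-! ### Uniform control of the forms defining `E`. -/

section Control

variable {M : Type*} [TopologicalSpace M] [ChartedSpace R3 M] [IsManifold (𝓡 3) ∞ M]

/-- Near `y` the plane field `E` is the kernel of a `1`-form which in some chart is normalised,
`C`-Lipschitz at `y`, and at `y` quantitatively nonzero on `F`. -/
def IsControlledAt (g : Metric M) (E F : PlaneField M) (C : ℝ) (y : M) : Prop :=
  ∃ c ∈ IsManifold.maximalAtlas (𝓡 3) ∞ M, y ∈ c.source ∧
    ∃ (ν : R3 → R3 →L[ℝ] ℝ) (w₀ : R3),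
      (∀ᶠ z in 𝓝 y, (∀ v ∈ E z, ν (c z) (chartD c z v) = 0) ∧ ν (c z) w₀ = 1 ∧
        ‖ν (c z) - ν (c y)‖ ≤ C * ‖c z - c y‖) ∧
      (∀ v : TangentSpace (𝓡 3) y, ‖chartD c y v‖ ≤ C * gNorm g v) ∧
      ∀ f ∈ F y, gNorm g f ≤ C * |ν (c y) (chartD c y f)|

theorem IsControlledAt.mono {g : Metric M} {E F : PlaneField M} {C C' : ℝ} {y : M}
    (h : IsControlledAt g E F C y) (hC : C ≤ C') : IsControlledAt g E F C' y := by
  obtain ⟨c, hc, hy, ν, w₀, h1, h2, h3⟩ := h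
  refine ⟨c, hc, hy, ν, w₀, ?_, fun v => (h2 v).trans ?_, fun f hf => (h3 f hf).trans ?_⟩
  · filter_upwards [h1] with z hz
    exact ⟨hz.1, hz.2.1, hz.2.2.trans (mul_le_mul_of_nonneg_right hC (norm_nonneg _))⟩
  · exact mul_le_mul_of_nonneg_right hC (gNorm_nonneg g v)
  · exact mul_le_mul_of_nonneg_right hC (abs_nonneg _)

theorem eventually_isControlledAt [T2Space M] [CompactSpace M] (g : Metric M) {E F : PlaneField M}
    (hE : IsLipschitzDistribution 2 E) (hF : IsLipschitzDistribution 1 F)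
    (hEF : ∀ x, IsCompl (E x) (F x)) (x₀ : M) :
    ∃ C, ∀ᶠ y in 𝓝 x₀, IsControlledAt g E F C y := by
  obtain ⟨U, hUo, hxU, hUs, V, hV, hVL⟩ := hE x₀
  obtain ⟨U', hUo', hxU', -, W, hW, hWL⟩ := hF x₀
  set c := chartAt R3 x₀ with hc
  have hcm : c ∈ IsManifold.maximalAtlas (𝓡 3) ∞ M := IsManifold.chart_mem_maximalAtlas x₀
  have hxs : x₀ ∈ c.source := mem_chart_source R3 x₀
  set V' : R3 → R3 × R3 := fun q => (inChart c (V 0) q, inChart c (V 1) q) with hV'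
  set W' : R3 → R3 := inChart c (W 0) with hW'
  obtain ⟨K₀, hK₀⟩ := hVL 0
  obtain ⟨K₁, hK₁⟩ := hVL 1
  obtain ⟨K₂, hK₂⟩ := hWL 0
  have hVlip : LipschitzOnWith (max K₀ K₁) V' (c '' U) := hK₀.prodMk hK₁
  have hUnhds : c '' U ∈ 𝓝 (c x₀) :=
    (c.isOpen_image_of_subset_source hUo hUs).mem_nhds (mem_image_of_mem _ hxU)
  have hWnhds : c '' (U' ∩ c.source) ∈ 𝓝 (c x₀) :=
    (c.isOpen_image_of_subset_source (hUo'.inter c.open_source) inter_subset_right).mem_nhds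
      (mem_image_of_mem _ ⟨hxU', hxs⟩)
  have hcc : ContinuousAt c x₀ := c.continuousAt hxs
  have hVc : ContinuousAt V' (c x₀) := hVlip.continuousOn.continuousAt hUnhds
  have hWc : ContinuousAt W' (c x₀) :=
    (hK₂.mono (image_mono inter_subset_left)).continuousOn.continuousAt hWnhds
  -- Normalising on the `F`-vector at `x₀` serves twice: it is transverse to `E`, so the form
  -- exists, and the form is 1 on it, hence above 1/2 on the frame of `F` nearby.
  set w₀ := W' (c x₀) with hw₀
  have hw₀D : w₀ = chartD c x₀ (W 0 x₀) := inChart_apply hxs (W 0)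
  have hWF : ∀ z ∈ U', W 0 z ∈ F z := fun z hz =>
    (hW z hz).2 ▸ Submodule.subset_span (mem_range_self 0)
  have htr : triple (V' (c x₀)).1 (V' (c x₀)).2 w₀ ≠ 0 := by
    rw [hw₀D, ne_eq, hV.triple_eq_zero_iff hcm hxU hxs]
    intro h
    exact (hW x₀ hxU').1.ne_zero 0
      ((Submodule.disjoint_def.mp (hEF x₀).disjoint) _ h (hWF x₀ hxU'))
  obtain ⟨L, t, ht, hL⟩ := (contDiffAt_normalForm htr).exists_lipschitzOnWith
  set ν : R3 → R3 →L[ℝ] ℝ := fun q => normalForm w₀ (V' q) with hν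
  have hνc : ContinuousAt (fun q => |ν q (W' q)|) (c x₀) :=
    ((ContinuousAt.comp (f := V') (x := c x₀) (g := normalForm w₀)
      (contDiffAt_normalForm htr).continuousAt hVc).clm_apply hWc).abs
  have hν0 : |ν (c x₀) (W' (c x₀))| = 1 := by
    change |normalForm w₀ ((V' (c x₀)).1, (V' (c x₀)).2) w₀| = 1
    rw [normalForm_apply, inv_mul_cancel₀ htr, abs_one]
  obtain ⟨N, hN, hNs, hNc⟩ := local_compact_nhds (c.open_source.mem_nhds hxs)
  obtain ⟨C₀, hC₀, hcomp⟩ := exists_norm_comparison g hcm hNc hNs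
  set B := ‖w₀‖ + 1 with hB
  have hS : ∀ᶠ z in 𝓝 x₀, z ∈ U ∧ z ∈ U' ∧ z ∈ c.source ∧ V' (c z) ∈ t ∧
      triple (V' (c z)).1 (V' (c z)).2 w₀ ≠ 0 ∧ 1 / 2 < |ν (c z) (W' (c z))| ∧
      ‖W' (c z)‖ < B ∧ z ∈ N := by
    have h1 := hcc.eventually (hVc.eventually
      ((contDiff_triple w₀).continuous.continuousAt.eventually_ne htr))
    have h2 := hcc.eventually (hνc.eventually (lt_mem_nhds (a := 1 / 2)
      (by simp only [hν0]; norm_num)))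
    have h3 := hcc.eventually (hWc.norm.eventually (gt_mem_nhds
      (show ‖W' (c x₀)‖ < B from lt_add_one ‖w₀‖)))
    filter_upwards [hUo.mem_nhds hxU, hUo'.mem_nhds hxU', c.open_source.mem_nhds hxs,
      hcc.eventually (hVc.eventually ht), h1, h2, h3, hN] with z a1 a2 a3 a4 a5 a6 a7 a8
    exact ⟨a1, a2, a3, a4, a5, a6, a7, a8⟩
  -- The entries are the Lipschitz constant of `ν`, the norm comparison, and the bound on `F`, whose
  -- factor 2 comes from the lower bound 1/2.
  refine ⟨max (L * max K₀ K₁ : NNReal) (max C₀ (2 * C₀ * B)), ?_⟩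
  -- Control at `y` concerns a neighbourhood of `y`, so the conditions are needed on a neighbourhood
  -- of each nearby `y`.
  filter_upwards [hS.eventually_nhds] with y hy
  obtain ⟨hyU, hyU', hys, hyt, -, hyν, hyB, hyN⟩ := hy.self_of_nhds
  refine ⟨c, hcm, hys, ν, w₀, ?_, fun v => ?_, fun f hf => ?_⟩
  · filter_upwards [hy] with z hz
    obtain ⟨hzU, -, hzs, hzt, hztr, -⟩ := hz
    refine ⟨fun v hv => ?_, ?_, ?_⟩
    · change normalForm w₀ ((V' (c z)).1, (V' (c z)).2) _ = 0
      rw [normalForm_apply, (hV.triple_eq_zero_iff hcm hzU hzs v).mpr hv, mul_zero]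
    · change normalForm w₀ ((V' (c z)).1, (V' (c z)).2) _ = 1
      rw [normalForm_apply, inv_mul_cancel₀ hztr]
    · have h1 := hL.dist_le_mul _ hzt _ hyt
      have h2 := hVlip.dist_le_mul _ (mem_image_of_mem c hzU) _ (mem_image_of_mem c hyU)
      rw [← dist_eq_norm, ← dist_eq_norm]
      calc dist (ν (c z)) (ν (c y)) ≤ L * dist (V' (c z)) (V' (c y)) := h1
        _ ≤ L * ((max K₀ K₁ : NNReal) * dist (c z) (c y)) := by gcongr
        _ = (L * max K₀ K₁ : NNReal) * dist (c z) (c y) := by push_cast; ring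
        _ ≤ _ := by gcongr; exact le_max_left _ _
  · refine (hcomp y hyN v).1.trans (mul_le_mul_of_nonneg_right ?_ (gNorm_nonneg g v))
    exact (le_max_left _ _).trans (le_max_right _ _)
  · rw [← (hW y hyU').2] at hf
    have hr : (range fun i : Fin 1 => W i y) = {W 0 y} := by
      ext u; simp [Fin.exists_fin_one, eq_comm]
    rw [hr, Submodule.mem_span_singleton] at hf
    obtain ⟨s, rfl⟩ := hf
    have h1 := (hcomp y hyN (W 0 y)).2
    have h2 : chartD c y (W 0 y) = W' (c y) := (inChart_apply hys (W 0)).symm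
    rw [gNorm_smul, map_smul, map_smul, h2, smul_eq_mul, abs_mul]
    rw [h2] at h1
    have h3 : gNorm g (W 0 y) ≤ 2 * C₀ * B * |ν (c y) (W' (c y))| := by
      have hBp : 0 < B := (norm_nonneg _).trans_lt hyB
      calc gNorm g (W 0 y) ≤ C₀ * ‖W' (c y)‖ := h1
        _ ≤ C₀ * B := by gcongr
        _ = 2 * C₀ * B * (1 / 2) := by ring
        _ ≤ _ := by gcongr
    calc |s| * gNorm g (W 0 y) ≤ |s| * (2 * C₀ * B * |ν (c y) (W' (c y))|) := by gcongr
      _ = 2 * C₀ * B * (|s| * |ν (c y) (W' (c y))|) := by ring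
      _ ≤ _ := by
        gcongr
        exact (le_max_right _ _).trans (le_max_right _ _)

theorem exists_isControlledAt [T2Space M] [CompactSpace M] (g : Metric M) {E F : PlaneField M}
    (hE : IsLipschitzDistribution 2 E) (hF : IsLipschitzDistribution 1 F)
    (hEF : ∀ x, IsCompl (E x) (F x)) : ∃ C, 0 < C ∧ ∀ y, IsControlledAt g E F C y := by
  have h : ∃ C, ∀ y ∈ (univ : Set M), IsControlledAt g E F C y := by
    refine isCompact_univ.induction_on (p := fun s => ∃ C, ∀ y ∈ s, IsControlledAt g E F C y)
      ⟨0, by simp⟩ (fun s t hst ⟨C, hC⟩ => ⟨C, fun y hy => hC y (hst hy)⟩) ?_ ?_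
    · rintro s t ⟨C, hC⟩ ⟨C', hC'⟩
      refine ⟨max C C', ?_⟩
      rintro y (hy | hy)
      · exact (hC y hy).mono (le_max_left _ _)
      · exact (hC' y hy).mono (le_max_right _ _)
    · intro x _
      obtain ⟨C, hC⟩ := eventually_isControlledAt g hE hF hEF x
      exact ⟨_, mem_nhdsWithin_of_mem_nhds hC, C, fun y hy => hy⟩
  obtain ⟨C, hC⟩ := h
  exact ⟨max C 1, by positivity, fun y => (hC y (mem_univ y)).mono (le_max_left _ _)⟩

end Control

/-! ### The form dx³ - a dx¹ - b dx² and its kernel. -/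

section GraphForm

/-- The vector `∂ᵢ + s ∂₃` of Euclidean 3-space. -/
noncomputable def graphVec (i : Fin 3) (s : ℝ) : R3 :=
  EuclideanSpace.single i (1 : ℝ) + s • EuclideanSpace.single 2 (1 : ℝ)

/-- The linear form `dx³ - s dx¹ - t dx²`. -/
noncomputable def graphForm (s t : ℝ) : R3 →L[ℝ] ℝ :=
  EuclideanSpace.proj (2 : Fin 3) - s • EuclideanSpace.proj (0 : Fin 3)
    - t • EuclideanSpace.proj (1 : Fin 3)

theorem graphForm_apply (s t : ℝ) (w : R3) : graphForm s t w = w 2 - s * w 0 - t * w 1 := by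
  simp [graphForm]

theorem norm_graphVec_le (i : Fin 3) (s : ℝ) : ‖graphVec i s‖ ≤ 1 + |s| := by
  refine (norm_add_le _ _).trans ?_
  simp [norm_smul]

theorem abs_graphForm_le (s t : ℝ) (w : R3) : |graphForm s t w| ≤ (1 + |s| + |t|) * ‖w‖ := by
  have h : ∀ i, |w i| ≤ ‖w‖ := fun i => PiLp.norm_apply_le w i
  rw [graphForm_apply]
  calc |w 2 - s * w 0 - t * w 1| ≤ |w 2| + |s| * |w 0| + |t| * |w 1| := by
        rw [← abs_mul, ← abs_mul]
        exact (abs_sub _ _).trans (add_le_add_left (abs_sub _ _) _)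
    _ ≤ ‖w‖ + |s| * ‖w‖ + |t| * ‖w‖ := by gcongr <;> exact h _
    _ = _ := by ring

theorem eq_graphVec_of_graphForm_eq_zero {s t : ℝ} {w : R3} (h : graphForm s t w = 0) :
    w = w 0 • graphVec 0 s + w 1 • graphVec 1 t := by
  rw [graphForm_apply] at h
  ext i
  fin_cases i <;> simp [graphVec]
  linarith

variable {M : Type*} [TopologicalSpace M] [ChartedSpace R3 M]
  {e : OpenPartialHomeomorph M R3} {E : PlaneField M} {a b : M → ℝ} {U : Set M}

theorem graphField_eq (i : Fin 3) (x : M) :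
    graphField e i a x = chartDinv e x (graphVec i (a x)) := by
  rw [graphVec, map_add, map_smul]
  rfl

theorem chartD_graphField (he : e ∈ IsManifold.maximalAtlas (𝓡 3) ∞ M) {x : M}
    (hx : x ∈ e.source) (i : Fin 3) : chartD e x (graphField e i a x) = graphVec i (a x) := by
  rw [graphField_eq, chartD_chartDinv he hx]

theorem chartDinv_mem_of_graphForm_eq_zero
    (hXY : IsFrameOn E ![graphField e 0 a, graphField e 1 b] U) {x : M} (hx : x ∈ U) {w : R3}
    (hw : graphForm (a x) (b x) w = 0) : chartDinv e x w ∈ E x := by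
  rw [eq_graphVec_of_graphForm_eq_zero hw, map_add, map_smul, map_smul, ← graphField_eq,
    ← graphField_eq, ← (hXY x hx).2]
  exact add_mem (Submodule.smul_mem _ _ (Submodule.subset_span ⟨0, rfl⟩))
    (Submodule.smul_mem _ _ (Submodule.subset_span ⟨1, rfl⟩))

end GraphForm

/-! ### Maps of `M` read in charts. -/

section ChartExpression

variable {M : Type*} [TopologicalSpace M] [ChartedSpace R3 M]
  {e c : OpenPartialHomeomorph M R3}

theorem hasFDerivAt_chart_comp (he : e ∈ IsManifold.maximalAtlas (𝓡 3) ∞ M)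
    (hc : c ∈ IsManifold.maximalAtlas (𝓡 3) ∞ M) {Φ : M → M} (hΦ : MDifferentiable (𝓡 3) (𝓡 3) Φ)
    {z : M} (hz : z ∈ e.source) (hΦz : Φ z ∈ c.source) :
    HasFDerivAt (fun q => c (Φ (e.symm q)))
      ((chartD c (Φ z)).comp ((mfderiv (𝓡 3) (𝓡 3) Φ z).comp (chartDinv e z))) (e z) := by
  have h1 : HasMFDerivAt (𝓡 3) (𝓡 3) e.symm (e z) (mfderiv (𝓡 3) (𝓡 3) e.symm (e z)) :=
    ((mdifferentiable_of_mem_maximalAtlas he).mdifferentiableAt_symm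
      (e.map_source hz)).hasMFDerivAt
  have h2 : HasMFDerivAt (𝓡 3) (𝓡 3) (fun y => c (Φ y)) z
      ((mfderiv (𝓡 3) (𝓡 3) c (Φ z)).comp (mfderiv (𝓡 3) (𝓡 3) Φ z)) :=
    HasMFDerivAt.comp z
      ((mdifferentiable_of_mem_maximalAtlas hc).mdifferentiableAt hΦz).hasMFDerivAt
      (hΦ z).hasMFDerivAt
  have h3 : ∀ z', z' = z → HasMFDerivAt (𝓡 3) (𝓡 3) (fun y => c (Φ y)) z'
      ((mfderiv (𝓡 3) (𝓡 3) c (Φ z)).comp (mfderiv (𝓡 3) (𝓡 3) Φ z) : R3 →L[ℝ] R3) := by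
    rintro z' rfl; exact h2
  exact (HasMFDerivAt.comp (e z) (h3 _ (e.left_inv hz)) h1).hasFDerivAt

theorem contDiffAt_chart_comp (he : e ∈ IsManifold.maximalAtlas (𝓡 3) ∞ M)
    (hc : c ∈ IsManifold.maximalAtlas (𝓡 3) ∞ M) {Φ : M → M} (hΦ : ContMDiff (𝓡 3) (𝓡 3) 2 Φ)
    {z : M} (hz : z ∈ e.source) (hΦz : Φ z ∈ c.source) :
    ContDiffAt ℝ 2 (fun q => c (Φ (e.symm q))) (e z) := by
  have h2 : (2 : WithTop ℕ∞) ≤ ∞ := WithTop.coe_le_coe.2 (le_top (a := (2 : ℕ∞)))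
  have k1 : ContMDiffAt (𝓡 3) (𝓡 3) 2 e.symm (e z) :=
    ((contMDiffOn_symm_of_mem_maximalAtlas he).contMDiffAt
      (e.open_target.mem_nhds (e.map_source hz))).of_le h2
  have k2 : ContMDiffAt (𝓡 3) (𝓡 3) 2 c (Φ (e.symm (e z))) := by
    rw [e.left_inv hz]
    exact ((contMDiffOn_of_mem_maximalAtlas hc).contMDiffAt (c.open_source.mem_nhds hΦz)).of_le h2
  rw [← contMDiffAt_iff_contDiffAt]
  exact k2.comp (e z) (hΦ.contMDiffAt.comp (e z) k1)

end ChartExpression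

/-! ### Bounding the bracket coefficient by the determinant ratio. -/

section CoefficientBound

variable {M : Type*} [TopologicalSpace M] [ChartedSpace R3 M]

/-- The coefficient `X b - Y a` of `∂₃` in the bracket of `X = ∂₁ + a ∂₃` and `Y = ∂₂ + b ∂₃`, in
the coordinates of the chart `e`. -/
noncomputable def bracketCoeff (e : OpenPartialHomeomorph M R3) (a b : M → ℝ) (x : M) : ℝ :=
  fderiv ℝ (fun q => b (e.symm q)) (e x) (graphVec 0 (a x))
    - fderiv ℝ (fun q => a (e.symm q)) (e x) (graphVec 1 (b x))

theorem mfderiv_diffeomorph_injective (Φ : M ≃ₘ^2⟮𝓡 3, 𝓡 3⟯ M) (x : M) :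
    Function.Injective (mfderiv (𝓡 3) (𝓡 3) Φ x) :=
  (Φ.mfderivToContinuousLinearEquiv (by norm_num) x).injective

variable [IsManifold (𝓡 3) ∞ M] {e : OpenPartialHomeomorph M R3} {E F : PlaneField M} {a b : M → ℝ}
  {U : Set M}

/-- Here `l` is the factor in Φ*ν = l η at `x`: the first estimate is that of the exterior
derivative, the second says that `l` records the expansion along `F`. -/
theorem mul_bracketCoeff_le (g : Metric M) (he : e ∈ IsManifold.maximalAtlas (𝓡 3) ∞ M)
    (hU : IsOpen U) (hUe : U ⊆ e.source)
    (hXY : IsFrameOn E ![graphField e 0 a, graphField e 1 b] U) {x : M} (hx : x ∈ U)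
    (hda : DifferentiableAt ℝ (fun q => a (e.symm q)) (e x))
    (hdb : DifferentiableAt ℝ (fun q => b (e.symm q)) (e x))
    (Φ : M ≃ₘ^2⟮𝓡 3, 𝓡 3⟯ M) (hΦE : ∀ z, (E z).map (mfderiv (𝓡 3) (𝓡 3) Φ z).toLinearMap = E (Φ z))
    {C : ℝ} (hC : 0 ≤ C) (hctrl : IsControlledAt g E F C (Φ x)) :
    ∃ l : ℝ, |l| * |bracketCoeff e a b x| ≤ 2 * C ^ 3 * √(gram g fun i =>
        mfderiv (𝓡 3) (𝓡 3) Φ x (![graphField e 0 a, graphField e 1 b] i x)).det ∧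
      ∀ f ∈ F (Φ x), ∀ f' : TangentSpace (𝓡 3) x, mfderiv (𝓡 3) (𝓡 3) Φ x f' = f →
        gNorm g f ≤ C * (|l| * |graphForm (a x) (b x) (chartD e x f')|) := by
  obtain ⟨c, hc, hΦx, ν, w₀, h1, h2, h3⟩ := hctrl
  have hxe := hUe hx
  have hΦd : MDifferentiable (𝓡 3) (𝓡 3) Φ := Φ.mdifferentiable (by norm_num)
  set A := mfderiv (𝓡 3) (𝓡 3) Φ x with hA
  set ψ : R3 → R3 := fun q => c (Φ (e.symm q)) with hψ
  set N : R3 → R3 →L[ℝ] ℝ := fun q => ν (ψ q) with hN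
  set η : R3 → R3 →L[ℝ] ℝ := fun q => graphForm (a (e.symm q)) (b (e.symm q)) with hη
  -- Since `η` is 1 on ∂₃, the factor can only be the value of the pullback on ∂₃.
  set l : R3 → ℝ := fun q => N q (fderiv ℝ ψ q (EuclideanSpace.single 2 1)) with hl
  have hsymm : Tendsto e.symm (𝓝 (e x)) (𝓝 x) := e.tendsto_symm hxe
  have hDψ : fderiv ℝ ψ (e x) = (chartD c (Φ x)).comp (A.comp (chartDinv e x)) :=
    (hasFDerivAt_chart_comp he hc hΦd hxe hΦx).fderiv
  have hηx : η (e x) = graphForm (a x) (b x) := by simp only [hη, e.left_inv hxe]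
  have hev : ∀ᶠ q in 𝓝 (e x), ∃ z ∈ U, e z = q ∧ Φ z ∈ c.source ∧
      (∀ v ∈ E (Φ z), ν (c (Φ z)) (chartD c (Φ z) v) = 0) ∧ ν (c (Φ z)) w₀ = 1 ∧
        ‖ν (c (Φ z)) - ν (c (Φ x))‖ ≤ C * ‖c (Φ z) - c (Φ x)‖ := by
    have hΦt : Tendsto (fun q => Φ (e.symm q)) (𝓝 (e x)) (𝓝 (Φ x)) :=
      (Φ.continuous.tendsto x).comp hsymm
    filter_upwards [hsymm.eventually (hU.mem_nhds hx), e.open_target.mem_nhds (e.map_source hxe),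
      hΦt.eventually (c.open_source.mem_nhds hΦx), hΦt.eventually h1] with q q1 q2 q3 q4
    exact ⟨e.symm q, q1, e.right_inv q2, q3, q4⟩
  have hpull : ∀ᶠ q in 𝓝 (e x), (N q).comp (fderiv ℝ ψ q) = l q • η q := by
    filter_upwards [hev] with q ⟨z, hzU, hzq, hzc, k1, _⟩
    subst hzq
    have hze := hUe hzU
    ext w
    -- Removing the ∂₃-component puts `w` in the kernel of `η`, that is in `E`; invariance sends it
    -- into `E`, where `ν` vanishes.
    have hw : graphForm (a z) (b z) (w - graphForm (a z) (b z) w • EuclideanSpace.single 2 1)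
        = 0 := by
      rw [map_sub, map_smul]
      have : graphForm (a z) (b z) (EuclideanSpace.single 2 (1 : ℝ)) = 1 := by
        simp [graphForm_apply]
      rw [this, smul_eq_mul, mul_one, sub_self]
    have hmem := chartDinv_mem_of_graphForm_eq_zero hXY hzU hw
    have hmem' := hΦE z ▸ Submodule.mem_map_of_mem (f := (mfderiv (𝓡 3) (𝓡 3) Φ z).toLinearMap) hmem
    have h0 := k1 _ hmem'
    have hD := (hasFDerivAt_chart_comp he hc hΦd hze hzc).fderiv
    have h0' : N (e z) (fderiv ℝ ψ (e z)
        (w - graphForm (a z) (b z) w • EuclideanSpace.single 2 1)) = 0 := by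
      rw [hD]
      simp only [hN, hψ, e.left_inv hze]
      exact h0
    rw [map_sub, map_sub, map_smul, map_smul, sub_eq_zero] at h0'
    rw [ContinuousLinearMap.comp_apply, h0', smul_apply, smul_eq_mul, smul_eq_mul, mul_comm]
    simp only [hl, hη, e.left_inv hze]
  have hw : ∀ᶠ q in 𝓝 (e x), N q w₀ = 1 := by
    filter_upwards [hev] with q ⟨z, hzU, hzq, hzc, _, k2, _⟩
    subst hzq
    simpa only [hN, hψ, e.left_inv (hUe hzU)] using k2
  have hK : ∀ᶠ q in 𝓝 (e x), ‖N q - N (e x)‖ ≤ C * ‖ψ q - ψ (e x)‖ := by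
    filter_upwards [hev] with q ⟨z, hzU, hzq, hzc, _, _, k3⟩
    subst hzq
    simpa only [hN, hψ, e.left_inv (hUe hzU), e.left_inv hxe] using k3
  have hinj : Function.Injective (fderiv ℝ ψ (e x)) := by
    rw [hDψ]
    exact (chartD_injective hc hΦx).comp
      ((mfderiv_diffeomorph_injective Φ x).comp (chartDinv_injective he hxe))
  have hinv : (fderiv ℝ ψ (e x)).IsInvertible :=
    ⟨(LinearEquiv.ofInjectiveEndo (fderiv ℝ ψ (e x)).toLinearMap hinj).toContinuousLinearEquiv,
      by ext v; rfl⟩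
  have hη' : HasFDerivAt η (-((fderiv ℝ (fun q => a (e.symm q)) (e x)).smulRight
      (EuclideanSpace.proj (0 : Fin 3) : R3 →L[ℝ] ℝ)) -
      (fderiv ℝ (fun q => b (e.symm q)) (e x)).smulRight
        (EuclideanSpace.proj (1 : Fin 3) : R3 →L[ℝ] ℝ)) (e x) := by
    have := ((hasFDerivAt_const (EuclideanSpace.proj (2 : Fin 3) : R3 →L[ℝ] ℝ) (e x)).sub
      (hda.hasFDerivAt.smul_const (EuclideanSpace.proj (0 : Fin 3) : R3 →L[ℝ] ℝ))).sub
      (hdb.hasFDerivAt.smul_const (EuclideanSpace.proj (1 : Fin 3) : R3 →L[ℝ] ℝ))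
    rwa [zero_sub] at this
  set v : Fin 2 → TangentSpace (𝓡 3) x :=
    fun i => ![graphField e 0 a, graphField e 1 b] i x with hv
  have hv0 : chartD e x (v 0) = graphVec 0 (a x) := chartD_graphField he hxe 0
  have hv1 : chartD e x (v 1) = graphVec 1 (b x) := chartD_graphField he hxe 1
  have hAv0 : A (v 0) ≠ 0 := by
    rw [map_ne_zero_iff _ (mfderiv_diffeomorph_injective Φ x)]
    exact (hXY x hx).1.ne_zero 0
  -- With this `t` the images of X and Y - tX are orthogonal, so the product of their lengths is the
  -- area; by antisymmetry the value of dη on the pair is unchanged.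
  obtain ⟨t, ht⟩ := exists_gNorm_mul_eq_sqrt_gram g (fun i => A (v i)) hAv0
  refine ⟨l (e x), ?_, fun f hf f' hf' => ?_⟩
  · have key := pullback_form_bound (contDiffAt_chart_comp he hc Φ.contMDiff hxe hΦx) hinv
      hη'.differentiableAt hpull hw hK
      (u := graphVec 0 (a x)) (v := graphVec 1 (b x) - t • graphVec 0 (a x))
      (by rw [hηx]; simp [graphForm_apply, graphVec])
      (by rw [hηx]; simp [graphForm_apply, graphVec]; ring)
    have e1 : fderiv ℝ η (e x) (graphVec 1 (b x) - t • graphVec 0 (a x)) (graphVec 0 (a x))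
        - fderiv ℝ η (e x) (graphVec 0 (a x)) (graphVec 1 (b x) - t • graphVec 0 (a x))
        = bracketCoeff e a b x := by
      rw [hη'.fderiv]
      simp only [sub_apply, neg_apply, ContinuousLinearMap.smulRight_apply, smul_apply,
        map_sub, map_smul, smul_eq_mul, bracketCoeff]
      simp [graphVec]
      ring
    rw [e1, hDψ] at key
    simp only [ContinuousLinearMap.comp_apply] at key
    rw [map_sub (chartDinv e x), map_smul (chartDinv e x), ← hv0, ← hv1,
      chartDinv_chartD he hxe, chartDinv_chartD he hxe, map_sub A, map_smul A] at key
    refine key.trans ?_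
    rw [← ht]
    have n1 := h2 (A (v 0))
    have n2 := h2 (A (v 1) - t • A (v 0))
    -- One factor `C` is the Lipschitz constant of `ν`; the other two pass from chart norms at `Φ x`
    -- to metric norms.
    calc _ ≤ 2 * C * ((C * gNorm g (A (v 0))) * (C * gNorm g (A (v 1) - t • A (v 0)))) :=
          mul_le_mul_of_nonneg_left (mul_le_mul n1 n2 (norm_nonneg _)
            (mul_nonneg hC (gNorm_nonneg g _))) (by positivity)
      _ = _ := by ring
  · have k := h3 f hf
    have e2 := congrArg (fun T => T (chartD e x f')) hpull.self_of_nhds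
    simp only [ContinuousLinearMap.comp_apply, smul_apply, smul_eq_mul, hηx, hDψ] at e2
    rw [chartDinv_chartD he hxe, hf'] at e2
    rw [← abs_mul, ← e2]
    simpa only [hN, hψ, e.left_inv hxe] using k

/-- The bracket coefficient is controlled by the ratio of the determinants of any diffeomorphism
preserving the splitting, with a constant independent of the diffeomorphism. -/
theorem bracketCoeff_le (g : Metric M) (he : e ∈ IsManifold.maximalAtlas (𝓡 3) ∞ M)
    (hU : IsOpen U) (hUe : U ⊆ e.source)
    (hXY : IsFrameOn E ![graphField e 0 a, graphField e 1 b] U)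
    (hF : IsLipschitzDistribution 1 F) {x : M} (hx : x ∈ U)
    (hda : DifferentiableAt ℝ (fun q => a (e.symm q)) (e x))
    (hdb : DifferentiableAt ℝ (fun q => b (e.symm q)) (e x))
    (Φ : M ≃ₘ^2⟮𝓡 3, 𝓡 3⟯ M) (hΦE : ∀ z, (E z).map (mfderiv (𝓡 3) (𝓡 3) Φ z).toLinearMap = E (Φ z))
    (hΦF : ∀ z, (F z).map (mfderiv (𝓡 3) (𝓡 3) Φ z).toLinearMap = F (Φ z))
    {C : ℝ} (hC : 0 < C) (hctrl : IsControlledAt g E F C (Φ x)) {C' : ℝ} (hC' : 0 < C')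
    (hcomp : ∀ v : TangentSpace (𝓡 3) x,
      ‖chartD e x v‖ ≤ C' * gNorm g v ∧ gNorm g v ≤ C' * ‖chartD e x v‖)
    (hax : |a x| ≤ C') (hbx : |b x| ≤ C') :
    |bracketCoeff e a b x| ≤ C * ((1 + C' + C') * C') * (2 * C ^ 3 * (C' * (1 + C')) ^ 2) *
      (absDetOn g (mfderiv (𝓡 3) (𝓡 3) Φ x) (E x) / absDetOn g (mfderiv (𝓡 3) (𝓡 3) Φ x) (F x)) := by
  obtain ⟨l, h1, h2⟩ := mul_bracketCoeff_le g he hU hUe hXY hx hda hdb Φ hΦE hC.le hctrl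
  have hxe := hUe hx
  set A := mfderiv (𝓡 3) (𝓡 3) Φ x with hA
  have hAinj : Function.Injective A := mfderiv_diffeomorph_injective Φ x
  set v : Fin 2 → TangentSpace (𝓡 3) x :=
    fun i => ![graphField e 0 a, graphField e 1 b] i x with hv
  have hdetE := absDetOn_eq_of_span g A (hXY x hx).1 (hXY x hx).2
  obtain ⟨W, -, hxW, -, w, hw, -⟩ := hF x
  have hdetF := absDetOn_eq_of_span g A (hw x hxW).1 (hw x hxW).2
  rw [gram_one, gram_one] at hdetF
  have hw0 : w 0 x ≠ 0 := (hw x hxW).1.ne_zero 0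
  have hwF : w 0 x ∈ F x := (hw x hxW).2 ▸ Submodule.subset_span (mem_range_self 0)
  have hgw := gNorm_pos g hw0
  have hgAw : 0 < gNorm g (A (w 0 x)) := gNorm_pos g ((map_ne_zero_iff _ hAinj).mpr hw0)
  have hFpos : 0 < absDetOn g A (F x) := by rw [hdetF]; positivity
  have hvpos := Real.sqrt_pos.mpr (gram_det_pos g (hXY x hx).1)
  have hEnn : 0 ≤ absDetOn g A (E x) := by rw [hdetE]; positivity
  -- The lower bound for `|l|`, tested on a vector spanning `F x`.
  have bF : absDetOn g A (F x) ≤ C * ((1 + C' + C') * C') * |l| := by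
    rw [hdetF, div_le_iff₀ hgw]
    refine (h2 _ (hΦF x ▸ Submodule.mem_map_of_mem (f := A.toLinearMap) hwF) _ rfl).trans ?_
    have k := abs_graphForm_le (a x) (b x) (chartD e x (w 0 x))
    calc _ ≤ C * (|l| * ((1 + C' + C') * (C' * gNorm g (w 0 x)))) := by
          gcongr
          refine k.trans ?_
          gcongr
          exact (hcomp _).1
      _ = _ := by ring
  -- The image area is the determinant on `E` times the area of (X, Y), which is bounded on `U`.
  have bE : √(gram g fun i => A (v i)).det ≤ absDetOn g A (E x) * (C' * (1 + C')) ^ 2 := by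
    have k0 : gNorm g (v 0) ≤ C' * (1 + C') := by
      refine (hcomp _).2.trans ?_
      have : chartD e x (v 0) = graphVec 0 (a x) := chartD_graphField he hxe 0
      rw [this]
      gcongr
      exact (norm_graphVec_le 0 _).trans (by gcongr)
    have k1 : gNorm g (v 1) ≤ C' * (1 + C') := by
      refine (hcomp _).2.trans ?_
      have : chartD e x (v 1) = graphVec 1 (b x) := chartD_graphField he hxe 1
      rw [this]
      gcongr
      exact (norm_graphVec_le 1 _).trans (by gcongr)
    have k2 : √(gram g fun i => A (v i)).det = absDetOn g A (E x) * √(gram g v).det := by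
      rw [hdetE]; exact (div_mul_cancel₀ _ hvpos.ne').symm
    rw [k2, sq]
    exact mul_le_mul_of_nonneg_left ((gram_two_le g v).trans
      (mul_le_mul k0 k1 (gNorm_nonneg g _) (by positivity))) hEnn
  rw [← mul_div_assoc, le_div_iff₀ hFpos]
  calc |bracketCoeff e a b x| * absDetOn g A (F x)
      ≤ |bracketCoeff e a b x| * (C * ((1 + C' + C') * C') * |l|) := by gcongr
    _ = C * ((1 + C' + C') * C') * (|l| * |bracketCoeff e a b x|) := by ring
    _ ≤ C * ((1 + C' + C') * C') * (2 * C ^ 3 * (absDetOn g A (E x) * (C' * (1 + C')) ^ 2)) := by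
        exact mul_le_mul_of_nonneg_left (h1.trans (by gcongr)) (by positivity)
    _ = _ := by ring

end CoefficientBound

/-! ### Vector fields and brackets on the model space. -/

section VectorSpace

/-- A vector field on Euclidean space is differentiable as a section of the tangent bundle iff it
is differentiable as a map. -/
theorem mdifferentiableAt_vectorSpace_iff {V : R3 → R3} {q : R3} :
    MDifferentiableAt (𝓡 3) (𝓡 3).tangent (fun p => (⟨p, V p⟩ : TangentBundle (𝓡 3) R3)) q ↔
      DifferentiableAt ℝ V q := by
  refine ⟨fun h => ?_, fun h => ?_⟩
  · exact (((contMDiff_snd_tangentBundle_modelSpace (n := 1) R3 (𝓡 3)).contMDiffAt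
      |>.mdifferentiableAt one_ne_zero).comp q h).differentiableAt
  · rw [mdifferentiableAt_totalSpace]
    refine ⟨mdifferentiableAt_id, ?_⟩
    convert! h.mdifferentiableAt with y
    simp

theorem mlieBracket_vectorSpace (V W : (q : R3) → TangentSpace (𝓡 3) q) (q : R3) :
    VectorField.mlieBracket (𝓡 3) V W q = VectorField.lieBracket ℝ V W q := by
  rw [← VectorField.mlieBracketWithin_univ, VectorField.mlieBracketWithin_eq_lieBracketWithin]
  exact congrFun (VectorField.lieBracketWithin_univ (𝕜 := ℝ) (E := R3) (V := V) (W := W)) q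

end VectorSpace

/-! ### Differentiability of `E` in terms of `a` and `b`, and the bracket in the chart. -/

section Regularity

variable {M : Type*} [TopologicalSpace M] [ChartedSpace R3 M]
  {e : OpenPartialHomeomorph M R3}

theorem isInvertible_mfderiv_chart (he : e ∈ IsManifold.maximalAtlas (𝓡 3) ∞ M) {x : M}
    (hx : x ∈ e.source) : (mfderiv (𝓡 3) (𝓡 3) e x).IsInvertible :=
  ⟨(mdifferentiable_of_mem_maximalAtlas he).mfderiv hx, rfl⟩

theorem isInvertible_mfderiv_chart_symm (he : e ∈ IsManifold.maximalAtlas (𝓡 3) ∞ M) {q : R3}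
    (hq : q ∈ e.target) : (mfderiv (𝓡 3) (𝓡 3) e.symm q).IsInvertible :=
  ⟨(mdifferentiable_of_mem_maximalAtlas he).symm.mfderiv hq, rfl⟩

theorem mpullback_chart_eq (he : e ∈ IsManifold.maximalAtlas (𝓡 3) ∞ M) {x : M}
    (hx : x ∈ e.source) (V : R3 → R3) :
    VectorField.mpullback (𝓡 3) (𝓡 3) e V x = chartDinv e x (V (e x)) := by
  exact congrArg (fun T => T (V (e x)))
    (ContinuousLinearMap.inverse_equiv ((mdifferentiable_of_mem_maximalAtlas he).mfderiv hx))

theorem mpullback_chart_symm_eq (he : e ∈ IsManifold.maximalAtlas (𝓡 3) ∞ M) {q : R3}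
    (hq : q ∈ e.target) (V : VField M) :
    VectorField.mpullback (𝓡 3) (𝓡 3) e.symm V q = inChart e V q := by
  exact congrArg (fun T => T (V (e.symm q)))
    (ContinuousLinearMap.inverse_equiv ((mdifferentiable_of_mem_maximalAtlas he).symm.mfderiv hq))

variable [IsManifold (𝓡 3) ∞ M] {E : PlaneField M} {a b : M → ℝ} {U : Set M}

theorem differentiableAt_inChart (he : e ∈ IsManifold.maximalAtlas (𝓡 3) ∞ M) {x : M}
    (hx : x ∈ e.source) {V : VField M}
    (hV : MDifferentiableAt (𝓡 3) (𝓡 3).tangent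
      (fun y => (⟨y, V y⟩ : TangentBundle (𝓡 3) M)) x) :
    DifferentiableAt ℝ (inChart e V) (e x) := by
  have : IsManifold (𝓡 3) 2 M := IsManifold.of_le (n := ∞) (WithTop.coe_le_coe.2 le_top)
  have hV' : MDifferentiableAt (𝓡 3) (𝓡 3).tangent
      (fun y => (⟨y, V y⟩ : TangentBundle (𝓡 3) M)) (e.symm (e x)) := by rwa [e.left_inv hx]
  have h := MDifferentiableAt.mpullback_vectorField (n := 2) hV'
    (((contMDiffOn_symm_of_mem_maximalAtlas he).contMDiffAt
      (e.open_target.mem_nhds (e.map_source hx))).of_le (WithTop.coe_le_coe.2 le_top))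
    (isInvertible_mfderiv_chart_symm he (e.map_source hx)) le_rfl
  refine (mdifferentiableAt_vectorSpace_iff.mp h).congr_of_eventuallyEq ?_
  filter_upwards [e.open_target.mem_nhds (e.map_source hx)] with q hq
  exact (mpullback_chart_symm_eq he hq V).symm

theorem mdifferentiableAt_of_chart (he : e ∈ IsManifold.maximalAtlas (𝓡 3) ∞ M) {x : M}
    (hx : x ∈ e.source) {V : VField M} {W : R3 → R3} (hW : DifferentiableAt ℝ W (e x))
    (hVW : ∀ᶠ y in 𝓝 x, V y = chartDinv e y (W (e y))) :
    MDifferentiableAt (𝓡 3) (𝓡 3).tangent (fun y => (⟨y, V y⟩ : TangentBundle (𝓡 3) M)) x := by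
  have : IsManifold (𝓡 3) 2 M := IsManifold.of_le (n := ∞) (WithTop.coe_le_coe.2 le_top)
  have h := MDifferentiableAt.mpullback_vectorField (n := 2)
    (mdifferentiableAt_vectorSpace_iff.mpr hW)
    (((contMDiffOn_of_mem_maximalAtlas he).contMDiffAt
      (e.open_source.mem_nhds hx)).of_le (WithTop.coe_le_coe.2 le_top))
    (isInvertible_mfderiv_chart he hx) le_rfl
  refine h.congr_of_eventuallyEq ?_
  filter_upwards [e.open_source.mem_nhds hx, hVW] with y hy hy'
  rw [hy', mpullback_chart_eq he hy]

theorem differentiableAt_graphVec {f : R3 → ℝ} {q : R3} (hf : DifferentiableAt ℝ f q) (i : Fin 3) :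
    DifferentiableAt ℝ (fun p => graphVec i (f p)) q :=
  (differentiableAt_const _).add (hf.smul_const _)

/-- The bracket of `∂₁ + a ∂₃` and `∂₂ + b ∂₃` at a point where `a` and `b` are differentiable. -/
theorem mlieBracket_graphField (he : e ∈ IsManifold.maximalAtlas (𝓡 3) ∞ M) {x : M}
    (hx : x ∈ e.source) (hda : DifferentiableAt ℝ (fun q => a (e.symm q)) (e x))
    (hdb : DifferentiableAt ℝ (fun q => b (e.symm q)) (e x)) :
    VectorField.mlieBracket (𝓡 3) (graphField e 0 a) (graphField e 1 b) x =
      bracketCoeff e a b x • chartDinv e x (EuclideanSpace.single 2 1) := by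
  have : IsManifold (𝓡 3) (minSmoothness ℝ 3) M := by
    rw [minSmoothness_of_isRCLikeNormedField]
    exact IsManifold.of_le (n := ∞) (WithTop.coe_le_coe.2 le_top)
  have h := VectorField.mpullback_mlieBracket (n := 2)
    (mdifferentiableAt_vectorSpace_iff.mpr (differentiableAt_graphVec hda 0))
    (mdifferentiableAt_vectorSpace_iff.mpr (differentiableAt_graphVec hdb 1))
    (((contMDiffOn_of_mem_maximalAtlas he).contMDiffAt
      (e.open_source.mem_nhds hx)).of_le (WithTop.coe_le_coe.2 le_top)) (by simp)
  have hX : ∀ (i : Fin 3) (f : M → ℝ), graphField e i f =ᶠ[𝓝 x]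
      VectorField.mpullback (𝓡 3) (𝓡 3) e (fun q => graphVec i (f (e.symm q))) := by
    intro i f
    filter_upwards [e.open_source.mem_nhds hx] with y hy
    rw [mpullback_chart_eq he hy, graphField_eq, e.left_inv hy]
  rw [(hX 0 a).mlieBracket_vectorField_eq (hX 1 b), ← h]
  refine (mpullback_chart_eq he hx _).trans ?_
  rw [← map_smul]
  congr 1
  refine (mlieBracket_vectorSpace _ _ _).trans ?_
  rw [VectorField.lieBracket]
  have d : ∀ (i : Fin 3) (f : M → ℝ), DifferentiableAt ℝ (fun q => f (e.symm q)) (e x) →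
      fderiv ℝ (fun q => graphVec i (f (e.symm q))) (e x) =
      (fderiv ℝ (fun q => f (e.symm q)) (e x)).smulRight (EuclideanSpace.single 2 (1 : ℝ)) := by
    intro i f hf
    have := (hasFDerivAt_const (EuclideanSpace.single i (1 : ℝ)) (e x)).add
      (hf.hasFDerivAt.smul_const (EuclideanSpace.single 2 (1 : ℝ)))
    rw [zero_add] at this
    exact this.fderiv
  rw [d 0 a hda, d 1 b hdb]
  simp only [e.left_inv hx, ContinuousLinearMap.smulRight_apply, bracketCoeff, sub_smul]
  rfl

theorem isDifferentiableAt_of_graph (he : e ∈ IsManifold.maximalAtlas (𝓡 3) ∞ M)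
    (hU : IsOpen U) (hUe : U ⊆ e.source)
    (hXY : IsFrameOn E ![graphField e 0 a, graphField e 1 b] U) {x : M} (hx : x ∈ U)
    (hda : DifferentiableAt ℝ (fun q => a (e.symm q)) (e x))
    (hdb : DifferentiableAt ℝ (fun q => b (e.symm q)) (e x)) : IsDifferentiableAt 2 E x := by
  have h : ∀ (i : Fin 3) (f : M → ℝ), DifferentiableAt ℝ (fun q => f (e.symm q)) (e x) →
      MDifferentiableAt (𝓡 3) (𝓡 3).tangent
        (fun y => (⟨y, graphField e i f y⟩ : TangentBundle (𝓡 3) M)) x := by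
    intro i f hf
    refine mdifferentiableAt_of_chart he (hUe hx) (differentiableAt_graphVec hf i) ?_
    filter_upwards [hU.mem_nhds hx] with y hy
    rw [graphField_eq, e.left_inv (hUe hy)]
  refine ⟨U, hU, hx, _, hXY, fun i => ?_⟩
  fin_cases i
  · exact h 0 a hda
  · exact h 1 b hdb

/-- If n is the determinant form of a frame differentiable at `x`, then n(∂₁ + a ∂₃) = 0 gives a =
-n(∂₁)/n(∂₃), and likewise for `b`. -/
theorem differentiableAt_of_isDifferentiableAt (he : e ∈ IsManifold.maximalAtlas (𝓡 3) ∞ M)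
    (hU : IsOpen U) (hUe : U ⊆ e.source)
    (hXY : IsFrameOn E ![graphField e 0 a, graphField e 1 b] U) {x : M} (hx : x ∈ U)
    (hE : IsDifferentiableAt 2 E x) :
    DifferentiableAt ℝ (fun q => a (e.symm q)) (e x) ∧
      DifferentiableAt ℝ (fun q => b (e.symm q)) (e x) := by
  obtain ⟨U', hU', hxU', V, hV, hVd⟩ := hE
  have hxe := hUe hx
  have hd : ∀ i, DifferentiableAt ℝ (inChart e (V i)) (e x) := fun i =>
    differentiableAt_inChart he hxe (hVd i)
  set n : R3 → R3 → ℝ := fun w q => triple (inChart e (V 0) q) (inChart e (V 1) q) w with hn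
  have hnd : ∀ w, DifferentiableAt ℝ (n w) (e x) := fun w =>
    ((contDiff_triple w).differentiable (by norm_num) _).comp (e x) ((hd 0).prodMk (hd 1))
  have hnadd : ∀ i s q, n (graphVec i s) q
      = n (EuclideanSpace.single i 1) q + s * n (EuclideanSpace.single 2 1) q := by
    intro i s q
    simp only [hn, ← tripleForm_apply]
    rw [graphVec, map_add, map_smul, smul_eq_mul]
  have hn0 : ∀ y ∈ U, y ∈ U' → n (graphVec 0 (a y)) (e y) = 0 ∧ n (graphVec 1 (b y)) (e y) = 0 := by
    intro y hy hy'
    have hye := hUe hy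
    rw [← chartD_graphField he hye, ← chartD_graphField he hye]
    simp only [hn]
    rw [hV.triple_eq_zero_iff he hy' hye, hV.triple_eq_zero_iff he hy' hye, ← (hXY y hy).2]
    exact ⟨Submodule.subset_span ⟨0, rfl⟩, Submodule.subset_span ⟨1, rfl⟩⟩
  have hn2 : ∀ y ∈ U, y ∈ U' → n (EuclideanSpace.single 2 1) (e y) ≠ 0 := by
    intro y hy hy'
    have hye := hUe hy
    rw [← chartD_chartDinv he hye (EuclideanSpace.single 2 1), hn]
    simp only [ne_eq]
    rw [hV.triple_eq_zero_iff he hy' hye, ← hXY.triple_eq_zero_iff he hy hye,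
      chartD_chartDinv he hye, inChart_apply hye, inChart_apply hye]
    have h0 : chartD e y (![graphField e 0 a, graphField e 1 b] 0 y) = graphVec 0 (a y) :=
      chartD_graphField he hye 0
    have h1 : chartD e y (![graphField e 0 a, graphField e 1 b] 1 y) = graphVec 1 (b y) :=
      chartD_graphField he hye 1
    rw [h0, h1]
    simp [triple, graphVec]
  have hmem : ∀ᶠ q in 𝓝 (e x), ∃ y, y ∈ U ∧ y ∈ U' ∧ e y = q := by
    filter_upwards [(e.tendsto_symm hxe).eventually ((hU.inter hU').mem_nhds ⟨hx, hxU'⟩),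
      e.open_target.mem_nhds (e.map_source hxe)] with q q1 q2
    exact ⟨e.symm q, q1.1, q1.2, e.right_inv q2⟩
  have hq : ∀ i, DifferentiableAt ℝ (fun q => -(n (EuclideanSpace.single i 1) q *
      (n (EuclideanSpace.single 2 1) q)⁻¹)) (e x) := fun i =>
    ((hnd _).mul ((hnd _).inv (hn2 x hx hxU'))).neg
  constructor
  · refine (hq 0).congr_of_eventuallyEq ?_
    filter_upwards [hmem] with q ⟨y, hy, hy', hyq⟩
    subst hyq
    rw [e.left_inv (hUe hy), ← div_eq_mul_inv, ← neg_div, eq_div_iff (hn2 y hy hy')]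
    linarith [(hn0 y hy hy').1, hnadd 0 (a y) (e y)]
  · refine (hq 1).congr_of_eventuallyEq ?_
    filter_upwards [hmem] with q ⟨y, hy, hy', hyq⟩
    subst hyq
    rw [e.left_inv (hUe hy), ← div_eq_mul_inv, ← neg_div, eq_div_iff (hn2 y hy hy')]
    linarith [(hn0 y hy hy').2, hnadd 1 (b y) (e y)]

end Regularity

/-! ### Iterates as diffeomorphisms preserving the splitting. -/

section Iterates

variable {M : Type*} [TopologicalSpace M] [ChartedSpace R3 M]

theorem exists_diffeomorph_iterate (φ : M ≃ₘ^2⟮𝓡 3, 𝓡 3⟯ M) {D : PlaneField M} {D' : PlaneField M}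
    (hD : ∀ x, (D x).map (mfderiv (𝓡 3) (𝓡 3) φ x).toLinearMap = D (φ x))
    (hD' : ∀ x, (D' x).map (mfderiv (𝓡 3) (𝓡 3) φ x).toLinearMap = D' (φ x)) (k : ℕ) :
    ∃ Φ : M ≃ₘ^2⟮𝓡 3, 𝓡 3⟯ M, ⇑Φ = φ^[k] ∧
      (∀ x, (D x).map (mfderiv (𝓡 3) (𝓡 3) Φ x).toLinearMap = D (Φ x)) ∧
      ∀ x, (D' x).map (mfderiv (𝓡 3) (𝓡 3) Φ x).toLinearMap = D' (Φ x) := by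
  induction k with
  | zero =>
    have h : ∀ D : PlaneField M, ∀ x, (D x).map
        (mfderiv (𝓡 3) (𝓡 3) (Diffeomorph.refl (𝓡 3) M 2) x).toLinearMap = D x := by
      intro D x
      have : mfderiv (𝓡 3) (𝓡 3) (Diffeomorph.refl (𝓡 3) M 2) x
          = ContinuousLinearMap.id ℝ (TangentSpace (𝓡 3) x) := mfderiv_id
      rw [this]
      exact Submodule.map_id _
    exact ⟨Diffeomorph.refl (𝓡 3) M 2, rfl, h D, h D'⟩
  | succ k ih =>
    obtain ⟨Φ, h1, h2, h3⟩ := ih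
    have h : ∀ D : PlaneField M, (∀ x, (D x).map (mfderiv (𝓡 3) (𝓡 3) φ x).toLinearMap = D (φ x)) →
        (∀ x, (D x).map (mfderiv (𝓡 3) (𝓡 3) Φ x).toLinearMap = D (Φ x)) →
        ∀ x, (D x).map (mfderiv (𝓡 3) (𝓡 3) (φ.trans Φ) x).toLinearMap = D (Φ (φ x)) := by
      intro D k1 k2 x
      have : mfderiv (𝓡 3) (𝓡 3) (φ.trans Φ) x
          = (mfderiv (𝓡 3) (𝓡 3) Φ (φ x)).comp (mfderiv (𝓡 3) (𝓡 3) φ x) :=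
        mfderiv_comp x (Φ.mdifferentiable (by norm_num) _) (φ.mdifferentiable (by norm_num) _)
      rw [this, ← k2, ← k1]
      exact Submodule.map_comp _ _ _
    refine ⟨φ.trans Φ, ?_, h D hD h2, h D' hD' h3⟩
    rw [Diffeomorph.coe_trans, h1]
    rfl

end Iterates

/-! ### The determinant ratio as a continuous cocycle. -/

section DetRatio

variable {M : Type*} [TopologicalSpace M] [ChartedSpace R3 M] [IsManifold (𝓡 3) ∞ M]
  {E F : PlaneField M}

theorem absDetOn_nonneg (g : Metric M) {x y : M}
    (A : TangentSpace (𝓡 3) x →L[ℝ] TangentSpace (𝓡 3) y)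
    (S : Submodule ℝ (TangentSpace (𝓡 3) x)) : 0 ≤ absDetOn g A S :=
  div_nonneg (Real.sqrt_nonneg _) (Real.sqrt_nonneg _)

theorem detRatio_nonneg (g : Metric M) (φ : M → M) (k : ℕ) (x : M) :
    0 ≤ detRatio g φ E F k x :=
  div_nonneg (absDetOn_nonneg g _ _) (absDetOn_nonneg g _ _)

theorem detRatio_one (g : Metric M) (φ : M → M) (x : M) :
    detRatio g φ E F 1 x = absDetOn g (mfderiv (𝓡 3) (𝓡 3) φ x) (E x) /
      absDetOn g (mfderiv (𝓡 3) (𝓡 3) φ x) (F x) :=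
  rfl

theorem gram_det_one_pos (g : Metric M) {x : M} {v : Fin 1 → TangentSpace (𝓡 3) x}
    (hv : LinearIndependent ℝ v) : 0 < (gram g v).det := by
  have := gNorm_pos g (hv.ne_zero 0)
  rw [← gram_one] at this
  exact Real.sqrt_pos.mp this

/-- `absDetOn` is multiplicative. -/
theorem absDetOn_comp (g : Metric M) {x y z : M}
    (A : TangentSpace (𝓡 3) x →L[ℝ] TangentSpace (𝓡 3) y)
    (B : TangentSpace (𝓡 3) y →L[ℝ] TangentSpace (𝓡 3) z) (hA : Function.Injective A)
    {S : Submodule ℝ (TangentSpace (𝓡 3) x)} {r : ℕ} {v : Fin r → TangentSpace (𝓡 3) x}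
    (hv : LinearIndependent ℝ v) (hS : Submodule.span ℝ (range v) = S)
    (hpos : 0 < (gram g fun i => A (v i)).det) :
    absDetOn g (B.comp A) S = absDetOn g B (S.map A.toLinearMap) * absDetOn g A S := by
  have h1 : LinearIndependent ℝ fun i => A (v i) :=
    hv.map' A.toLinearMap (LinearMap.ker_eq_bot.mpr hA)
  have h2 : Submodule.span ℝ (range fun i => A (v i)) = S.map A.toLinearMap := by
    rw [← hS, Submodule.map_span, ← range_comp]
    rfl
  rw [absDetOn_eq_of_span g _ hv hS, absDetOn_eq_of_span g A hv hS, absDetOn_eq_of_span g B h1 h2,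
    div_mul_div_cancel₀ (Real.sqrt_pos.mpr hpos).ne']
  rfl

/-- Chain rule for φᵏ ∘ φ; invariance identifies the image subspaces with the fibres at `φ x`. -/
theorem detRatio_succ (g : Metric M) (φ : M ≃ₘ^2⟮𝓡 3, 𝓡 3⟯ M)
    (hEF : IsInvariantLipschitzSplitting φ E F) (k : ℕ) (x : M) :
    detRatio g φ E F (k + 1) x = detRatio g φ E F k (φ x) * detRatio g φ E F 1 x := by
  obtain ⟨U, -, hxU, -, V, hV, -⟩ := hEF.lipschitz_left x
  obtain ⟨U', -, hxU', -, W, hW, -⟩ := hEF.lipschitz_right x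
  have hd : MDifferentiable (𝓡 3) (𝓡 3) φ := φ.mdifferentiable (by norm_num)
  have hk : ∀ k, MDifferentiable (𝓡 3) (𝓡 3) φ^[k] := by
    intro k
    induction k with
    | zero => exact mdifferentiable_id
    | succ k ih => exact ih.comp hd
  have hinj := mfderiv_diffeomorph_injective φ x
  have hD : mfderiv (𝓡 3) (𝓡 3) φ^[k + 1] x
      = (mfderiv (𝓡 3) (𝓡 3) φ^[k] (φ x)).comp (mfderiv (𝓡 3) (𝓡 3) φ x) :=
    mfderiv_comp x (hk k (φ x)) (hd x)
  have hvE := (hV x hxU).1.map' (mfderiv (𝓡 3) (𝓡 3) φ x).toLinearMap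
    (LinearMap.ker_eq_bot.mpr hinj)
  have hvF := (hW x hxU').1.map' (mfderiv (𝓡 3) (𝓡 3) φ x).toLinearMap
    (LinearMap.ker_eq_bot.mpr hinj)
  have e1 : absDetOn g (mfderiv (𝓡 3) (𝓡 3) φ^[k + 1] x) (E x)
      = absDetOn g (mfderiv (𝓡 3) (𝓡 3) φ^[k] (φ x)) (E (φ x))
        * absDetOn g (mfderiv (𝓡 3) (𝓡 3) φ x) (E x) := by
    rw [← hEF.map_left x]
    exact (congrArg (fun T => absDetOn g T (E x)) hD).trans
      (absDetOn_comp g _ _ hinj (hV x hxU).1 (hV x hxU).2 (gram_det_pos g hvE))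
  have e2 : absDetOn g (mfderiv (𝓡 3) (𝓡 3) φ^[k + 1] x) (F x)
      = absDetOn g (mfderiv (𝓡 3) (𝓡 3) φ^[k] (φ x)) (F (φ x))
        * absDetOn g (mfderiv (𝓡 3) (𝓡 3) φ x) (F x) := by
    rw [← hEF.map_right x]
    exact (congrArg (fun T => absDetOn g T (F x)) hD).trans
      (absDetOn_comp g _ _ hinj (hW x hxU').1 (hW x hxU').2 (gram_det_one_pos g hvF))
  rw [detRatio_one, detRatio, detRatio, e1, e2, mul_div_mul_comm]

/-- Starting at exponent 1 makes the hypothesis the base case. -/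
theorem detRatio_le_pow (g : Metric M) (φ : M ≃ₘ^2⟮𝓡 3, 𝓡 3⟯ M)
    (hEF : IsInvariantLipschitzSplitting φ E F) {τ : ℝ} (hτ : ∀ x, detRatio g φ E F 1 x ≤ τ)
    (k : ℕ) (x : M) : detRatio g φ E F (k + 1) x ≤ τ ^ (k + 1) := by
  induction k generalizing x with
  | zero => simpa using hτ x
  | succ k ih =>
    rw [detRatio_succ g φ hEF, pow_succ]
    exact mul_le_mul (ih _) (hτ x) (detRatio_nonneg g _ _ _)
      ((detRatio_nonneg g _ _ _).trans (ih (φ x)))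

/-- A frame that is Lipschitz in the chart is continuous as a family of sections of `TM`. -/
theorem continuousAt_of_lipschitz_inChart {x₀ : M} {U : Set M} (hU : IsOpen U) (hx : x₀ ∈ U)
    (hUs : U ⊆ (chartAt R3 x₀).source) {V : VField M} {K : NNReal}
    (hV : LipschitzOnWith K (inChart (chartAt R3 x₀) V) (chartAt R3 x₀ '' U)) :
    ContinuousAt (fun y => (⟨y, V y⟩ : TangentBundle (𝓡 3) M)) x₀ := by
  set c := chartAt R3 x₀
  have hcm : c ∈ IsManifold.maximalAtlas (𝓡 3) ∞ M := IsManifold.chart_mem_maximalAtlas x₀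
  have h1 : ContinuousAt (inChart c V) (c x₀) := hV.continuousOn.continuousAt
    ((c.isOpen_image_of_subset_source hU hUs).mem_nhds (mem_image_of_mem _ hx))
  have h2 : ContinuousAt (fun y => inChart c V (c y)) x₀ :=
    ContinuousAt.comp (g := inChart c V) h1 (c.continuousAt (hUs hx))
  refine (continuousAt_chartDinv hcm (b := fun y : M => y) continuousAt_id h2 (hUs hx)).congr ?_
  filter_upwards [hU.mem_nhds hx] with y hy
  rw [inChart_apply (hUs hy), chartDinv_chartD hcm (hUs hy)]

theorem continuousAt_gram_det (g : Metric M) {b : M → M} {r : ℕ}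
    {v : Fin r → ∀ y : M, TangentSpace (𝓡 3) (b y)} {x₀ : M}
    (hv : ∀ i, ContinuousAt (fun y => (⟨b y, v i y⟩ : TangentBundle (𝓡 3) M)) x₀) :
    ContinuousAt (fun y => √(gram g fun i => v i y).det) x₀ := by
  refine ContinuousAt.sqrt ?_
  have : ContinuousAt (fun y => gram g fun i => v i y) x₀ :=
    continuousAt_pi.mpr fun i => continuousAt_pi.mpr fun j => g.continuousAt_inner (hv i) (hv j)
  exact (Continuous.matrix_det continuous_id).continuousAt.comp this

theorem continuousAt_absDetOn (g : Metric M) (φ : M ≃ₘ^2⟮𝓡 3, 𝓡 3⟯ M) {D : PlaneField M} {r : ℕ}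
    (hD : IsLipschitzDistribution r D)
    (hpos : ∀ {y : M} {v : Fin r → TangentSpace (𝓡 3) y}, LinearIndependent ℝ v →
      0 < (gram g v).det) (x₀ : M) :
    ContinuousAt (fun y => absDetOn g (mfderiv (𝓡 3) (𝓡 3) φ y) (D y)) x₀ := by
  have : IsManifold (𝓡 3) 1 M := IsManifold.of_le (n := ∞) (by norm_num)
  obtain ⟨U, hUo, hxU, hUs, V, hV, hVL⟩ := hD x₀
  have hc : ∀ i, ContinuousAt (fun y => (⟨y, V i y⟩ : TangentBundle (𝓡 3) M)) x₀ := fun i =>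
    continuousAt_of_lipschitz_inChart hUo hxU hUs (hVL i).choose_spec
  have hc' : ∀ i, ContinuousAt
      (fun y => (⟨φ y, mfderiv (𝓡 3) (𝓡 3) φ y (V i y)⟩ : TangentBundle (𝓡 3) M)) x₀ := fun i =>
    ContinuousAt.comp (g := tangentMap (𝓡 3) (𝓡 3) φ)
      (φ.contMDiff.continuous_tangentMap (by norm_num)).continuousAt (hc i)
  refine ((continuousAt_gram_det g hc').div (continuousAt_gram_det g (b := fun y => y) hc)
    (Real.sqrt_pos.mpr (hpos (hV x₀ hxU).1)).ne').congr ?_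
  filter_upwards [hUo.mem_nhds hxU] with y hy
  exact (absDetOn_eq_of_span g _ (hV y hy).1 (hV y hy).2).symm

theorem continuous_detRatio (g : Metric M) (φ : M ≃ₘ^2⟮𝓡 3, 𝓡 3⟯ M)
    (hEF : IsInvariantLipschitzSplitting φ E F) :
    Continuous fun x => detRatio g φ E F 1 x := by
  rw [continuous_iff_continuousAt]
  intro x₀
  simp only [detRatio_one]
  refine (continuousAt_absDetOn g φ hEF.lipschitz_left (gram_det_pos g) x₀).div
    (continuousAt_absDetOn g φ hEF.lipschitz_right (gram_det_one_pos g) x₀) ?_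
  obtain ⟨U', -, hxU', -, W, hW, -⟩ := hEF.lipschitz_right x₀
  rw [absDetOn_eq_of_span g _ (hW x₀ hxU').1 (hW x₀ hxU').2]
  have hvF := (hW x₀ hxU').1.map' (mfderiv (𝓡 3) (𝓡 3) φ x₀).toLinearMap
    (LinearMap.ker_eq_bot.mpr (mfderiv_diffeomorph_injective φ x₀))
  exact (div_pos (Real.sqrt_pos.mpr (gram_det_one_pos g hvF))
    (Real.sqrt_pos.mpr (gram_det_one_pos g (hW x₀ hxU').1))).ne'

/-- A continuous function attains its maximum on a compact space; empty `M` has no maximum point and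
is treated apart. -/
theorem exists_detRatio_le_lt_one [CompactSpace M] (g : Metric M) (φ : M ≃ₘ^2⟮𝓡 3, 𝓡 3⟯ M)
    (hEF : IsInvariantLipschitzSplitting φ E F) (h : ∀ x, detRatio g φ E F 1 x < 1) :
    ∃ τ : ℝ, 0 ≤ τ ∧ τ < 1 ∧ ∀ x, detRatio g φ E F 1 x ≤ τ := by
  rcases isEmpty_or_nonempty M with hM | hM
  · exact ⟨0, le_rfl, one_pos, fun x => isEmptyElim x⟩
  · obtain ⟨x₀, -, hx₀⟩ := isCompact_univ.exists_isMaxOn univ_nonempty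
      (continuous_detRatio g φ hEF).continuousOn
    exact ⟨_, detRatio_nonneg g _ _ _, h x₀, fun x => hx₀ (mem_univ x)⟩

end DetRatio

/-! ### The bracket estimate and its vanishing under domination. -/

section BracketBound

variable {M : Type*} [TopologicalSpace M] [ChartedSpace R3 M]

theorem exists_abs_le_of_lipschitz_inChart {M : Type*} [TopologicalSpace M] [CompactSpace M]
    {e : OpenPartialHomeomorph M R3} {U : Set M}
    (hUe : closure U ⊆ e.source) {a : M → ℝ}
    (ha : ∃ K, LipschitzOnWith K (fun p => a (e.symm p)) (e '' U)) :
    ∃ C, ∀ x ∈ U, |a x| ≤ C := by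
  obtain ⟨K, hK⟩ := ha
  have hb : Bornology.IsBounded (e '' U) :=
    ((isClosed_closure.isCompact).image_of_continuousOn (e.continuousOn.mono hUe)).isBounded.subset
      (image_mono subset_closure)
  obtain ⟨D, hD⟩ := Metric.isBounded_iff.mp hb
  rcases U.eq_empty_or_nonempty with rfl | ⟨x₀, hx₀⟩
  · exact ⟨0, by simp⟩
  refine ⟨|a x₀| + K * D, fun x hx => ?_⟩
  have h := hK.dist_le_mul _ (mem_image_of_mem e hx) _ (mem_image_of_mem e hx₀)
  simp only [e.left_inv (hUe (subset_closure hx)), e.left_inv (hUe (subset_closure hx₀)),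
    Real.dist_eq] at h
  have h2 := hD (mem_image_of_mem e hx) (mem_image_of_mem e hx₀)
  have h3 : (K : ℝ) * dist (e x) (e x₀) ≤ K * D := by gcongr
  have h4 := abs_sub_abs_le_abs_sub (a x) (a x₀)
  linarith

variable [IsManifold (𝓡 3) ∞ M]

/-- Rademacher's theorem for `a` and `b` in the coordinates. -/
theorem ae_isDifferentiableAt {E : PlaneField M} {e : OpenPartialHomeomorph M R3}
    (he : e ∈ IsManifold.maximalAtlas (𝓡 3) ∞ M) {U : Set M} (hU : IsOpen U)
    (hUe : U ⊆ e.source) {a b : M → ℝ}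
    (ha : ∃ K, LipschitzOnWith K (fun p => a (e.symm p)) (e '' U))
    (hb : ∃ K, LipschitzOnWith K (fun p => b (e.symm p)) (e '' U))
    (hXY : IsFrameOn E ![graphField e 0 a, graphField e 1 b] U) :
    ∀ᵐ p ∂(volume.restrict (e '' U)), e.symm p ∈ U ∧ IsDifferentiableAt 2 E (e.symm p) := by
  have hO : IsOpen (e '' U) := e.isOpen_image_of_subset_source hU hUe
  obtain ⟨K, hK⟩ := ha
  obtain ⟨K', hK'⟩ := hb
  filter_upwards [hK.ae_differentiableWithinAt hO.measurableSet,
    hK'.ae_differentiableWithinAt hO.measurableSet, ae_restrict_mem hO.measurableSet]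
    with p h1 h2 ⟨x, hx, hxp⟩
  subst hxp
  have hm := hO.mem_nhds (mem_image_of_mem e hx)
  rw [e.left_inv (hUe hx)]
  exact ⟨hx, isDifferentiableAt_of_graph he hU hUe hXY hx (h1.differentiableAt hm)
    (h2.differentiableAt hm)⟩

variable [T2Space M] [CompactSpace M]

theorem exists_gNorm_mlieBracket_le (g : Metric M) (φ : M ≃ₘ^2⟮𝓡 3, 𝓡 3⟯ M) {E F : PlaneField M}
    (hEF : IsInvariantLipschitzSplitting φ E F) {e : OpenPartialHomeomorph M R3}
    (he : e ∈ IsManifold.maximalAtlas (𝓡 3) ∞ M) {U : Set M} (hU : IsOpen U)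
    (hUe : closure U ⊆ e.source) {a b : M → ℝ}
    (ha : ∃ K, LipschitzOnWith K (fun p => a (e.symm p)) (e '' U))
    (hb : ∃ K, LipschitzOnWith K (fun p => b (e.symm p)) (e '' U))
    (hXY : IsFrameOn E ![graphField e 0 a, graphField e 1 b] U) :
    ∃ C : ℝ, 0 < C ∧ ∀ k : ℕ, ∀ x ∈ U, IsDifferentiableAt 2 E x →
      gNorm g (VectorField.mlieBracket (𝓡 3) (graphField e 0 a) (graphField e 1 b) x) ≤
        C * detRatio g φ E F k x := by
  have hUs : U ⊆ e.source := subset_closure.trans hUe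
  obtain ⟨C, hC, hctrl⟩ :=
    exists_isControlledAt g hEF.lipschitz_left hEF.lipschitz_right hEF.isCompl
  obtain ⟨C₁, hC₁, hcomp⟩ := exists_norm_comparison g he (isClosed_closure.isCompact) hUe
  obtain ⟨C₂, hC₂⟩ := exists_abs_le_of_lipschitz_inChart hUe ha
  obtain ⟨C₃, hC₃⟩ := exists_abs_le_of_lipschitz_inChart hUe hb
  set C' := max C₁ (max C₂ C₃) with hC'
  have h1 : C₁ ≤ C' := le_max_left _ _
  have h2 : C₂ ≤ C' := (le_max_left _ _).trans (le_max_right _ _)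
  have h3 : C₃ ≤ C' := (le_max_right _ _).trans (le_max_right _ _)
  have hC'0 : 0 < C' := hC₁.trans_le h1
  have hcomp' : ∀ y ∈ U, ∀ v : TangentSpace (𝓡 3) y,
      ‖chartD e y v‖ ≤ C' * gNorm g v ∧ gNorm g v ≤ C' * ‖chartD e y v‖ := fun y hy v =>
    ⟨(hcomp y (subset_closure hy) v).1.trans (mul_le_mul_of_nonneg_right h1 (gNorm_nonneg g v)),
      (hcomp y (subset_closure hy) v).2.trans (mul_le_mul_of_nonneg_right h1 (norm_nonneg _))⟩
  refine ⟨C' * (C * ((1 + C' + C') * C') * (2 * C ^ 3 * (C' * (1 + C')) ^ 2)), by positivity,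
    fun k x hx hE => ?_⟩
  obtain ⟨hda, hdb⟩ := differentiableAt_of_isDifferentiableAt he hU hUs hXY hx hE
  obtain ⟨Φ, hΦ, hΦE, hΦF⟩ := exists_diffeomorph_iterate φ hEF.map_left hEF.map_right k
  have key := bracketCoeff_le g he hU hUs hXY hEF.lipschitz_right hx hda hdb Φ hΦE hΦF hC
    (hctrl (Φ x)) hC'0 (hcomp' x hx) ((hC₂ x hx).trans h2) ((hC₃ x hx).trans h3)
  have hr : absDetOn g (mfderiv (𝓡 3) (𝓡 3) Φ x) (E x) / absDetOn g (mfderiv (𝓡 3) (𝓡 3) Φ x) (F x)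
      = detRatio g φ E F k x := by
    rw [detRatio, ← hΦ]
  rw [hr] at key
  rw [mlieBracket_graphField he (hUs hx) hda hdb, gNorm_smul]
  have h4 := (hcomp' x hx (chartDinv e x (EuclideanSpace.single 2 1))).2
  rw [chartD_chartDinv he (hUs hx), PiLp.norm_single, norm_one, mul_one] at h4
  rw [mul_assoc, mul_comm C']
  exact mul_le_mul key h4 (gNorm_nonneg g _)
    (mul_nonneg (by positivity) (detRatio_nonneg g _ _ _))

theorem mlieBracket_eq_zero_of_isVolumeDominated (φ : M ≃ₘ^2⟮𝓡 3, 𝓡 3⟯ M) {E F : PlaneField M}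
    (hEF : IsInvariantLipschitzSplitting φ E F) (hdom : IsVolumeDominated φ E F)
    {e : OpenPartialHomeomorph M R3}
    (he : e ∈ IsManifold.maximalAtlas (𝓡 3) ∞ M) {U : Set M} (hU : IsOpen U)
    (hUe : closure U ⊆ e.source) {a b : M → ℝ}
    (ha : ∃ K, LipschitzOnWith K (fun p => a (e.symm p)) (e '' U))
    (hb : ∃ K, LipschitzOnWith K (fun p => b (e.symm p)) (e '' U))
    (hXY : IsFrameOn E ![graphField e 0 a, graphField e 1 b] U) {x : M} (hx : x ∈ U)
    (hE : IsDifferentiableAt 2 E x) :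
    VectorField.mlieBracket (𝓡 3) (graphField e 0 a) (graphField e 1 b) x = 0 := by
  -- The estimate is applied with the metric that realises the domination; vanishing of the bracket
  -- does not depend on the metric.
  obtain ⟨g, hg⟩ := hdom
  obtain ⟨C, hC, hbound⟩ := exists_gNorm_mlieBracket_le g φ hEF he hU hUe ha hb hXY
  obtain ⟨τ, hτ0, hτ1, hτ⟩ := exists_detRatio_le_lt_one g φ hEF hg
  by_contra hne
  have hlim : Tendsto (fun k : ℕ => C * τ ^ (k + 1)) atTop (𝓝 0) := by
    have := ((tendsto_pow_atTop_nhds_zero_of_lt_one hτ0 hτ1).comp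
      (tendsto_add_atTop_nat 1)).const_mul C
    rwa [mul_zero] at this
  have hle := ge_of_tendsto' hlim fun k => (hbound (k + 1) x hx hE).trans
    (mul_le_mul_of_nonneg_left (detRatio_le_pow g φ hEF hτ k x) hC.le)
  exact (gNorm_pos g hne).not_ge hle

end BracketBound

end LipBracket

theorem mainTheorem3 {M : Type*} [TopologicalSpace M] [T2Space M] [CompactSpace M]
    [ChartedSpace LipBracket.R3 M] [IsManifold (𝓡 3) ∞ M]
    (g : LipBracket.Metric M) (φ : M ≃ₘ^2⟮𝓡 3, 𝓡 3⟯ M)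
    (E F : LipBracket.PlaneField M)
    (hEF : LipBracket.IsInvariantLipschitzSplitting φ E F)
    (e : OpenPartialHomeomorph M LipBracket.R3) (he : e ∈ IsManifold.maximalAtlas (𝓡 3) ∞ M)
    (U : Set M) (hU : IsOpen U) (hUe : closure U ⊆ e.source)
    (a b : M → ℝ)
    (ha : ∃ K, LipschitzOnWith K (fun p => a (e.symm p)) (e '' U))
    (hb : ∃ K, LipschitzOnWith K (fun p => b (e.symm p)) (e '' U))
    (X Y : LipBracket.VField M)
    (hX : X = LipBracket.graphField e 0 a) (hY : Y = LipBracket.graphField e 1 b)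
    (hXY : LipBracket.IsFrameOn E ![X, Y] U) :
    (∃ C : ℝ, 0 < C ∧ ∀ k : ℕ, ∀ x ∈ U, LipBracket.IsDifferentiableAt 2 E x →
      LipBracket.gNorm g (VectorField.mlieBracket (𝓡 3) X Y x) ≤
        C * LipBracket.detRatio g φ E F k x) ∧
    (LipBracket.IsVolumeDominated φ E F →
      (∀ x ∈ U, LipBracket.IsDifferentiableAt 2 E x →
        VectorField.mlieBracket (𝓡 3) X Y x = 0) ∧
      ∀ᵐ p ∂(volume.restrict (e '' U)), LipBracket.IsDifferentiableAt 2 E (e.symm p) ∧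
        VectorField.mlieBracket (𝓡 3) X Y (e.symm p) = 0) := by
  subst hX hY
  have hUe' : U ⊆ e.source := subset_closure.trans hUe
  refine ⟨LipBracket.exists_gNorm_mlieBracket_le g φ hEF he hU hUe ha hb hXY, fun hdom => ?_⟩
  have hzero := fun x (hx : x ∈ U) (hE : LipBracket.IsDifferentiableAt 2 E x) =>
    LipBracket.mlieBracket_eq_zero_of_isVolumeDominated φ hEF hdom he hU hUe ha hb hXY hx hE
  refine ⟨hzero, ?_⟩
  filter_upwards [LipBracket.ae_isDifferentiableAt he hU hUe' ha hb hXY] with p hp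
  exact ⟨hp.2, hzero _ hp.1 hp.2⟩
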